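/- Let $\mathbb{H}=\{u=(u_1,u_2)\in\mathbb{R}^2 : u_2<0\}$ and $$\Psi(u)=-\frac{u_1^2}{4u_2}-\frac12\log(-2u_2).$$ The Hessian $g=(\partial_i\partial_j\Psi)$ is a Riemannian metric on $\mathbb{H}$; it is the Fisher information metric of the univariate normal distributions $N(\mu,\sigma^2)$ in the natural parameters $u_1=\mu/\sigma^2$, $u_2=-1/(2\sigma^2)$. Let $D$ be the flat connection given by differentiation in the $u$-coordinates, and let $X^H$ and $X^V$ be the horizontal (with respect to $D$) and vertical lifts of a tangent vector $X$ of $\mathbb{H}$ to $T\mathbb{H}=\mathbb{H}\times\mathbb{R}^2$. Let $(g^D,J^D)$ be the Sasaki structure on $T\mathbb{H}$: $$J^DX^H=X^V,\quad J^DX^V=-X^H,\quad g^D(X^H,Y^H)=g^D(X^V,Y^V)=g(X,Y),\quad g^D(X^H,Y^V)=0.$$ Let $R$ be the Riemann curvature tensor of $g^D$, with the sign for which $R(X,Y,X,Y)$ is the sectional curvature of the plane spanned by orthonormal $X,Y$. For tangent vectors $\xi,\eta$ of $\mathbb{H}$ at $u$, extended to $T\mathbb{H}$ at $(u,v)$ by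 their horizontal lifts, let $$\mathfrak{A}(\eta,\xi)=R(\xi,J^D\eta,\xi,J^D\eta)-R(\eta,\xi,\eta,\xi)$$ be the anti-bisectional curvature; its restriction to pairs with $g(\xi,\eta)=0$ is the orthogonal anti-bisectional curvature $\mathfrak{OA}$. Then: 1. $(T\mathbb{H},g^D,J^D)$ is a complete (connected) Kähler surface. 2. At every point $(u,v)\in T\mathbb{H}$ and for every $a\in\mathbb{R}$, the vector $\xi=\partial_{u_1}+a\,\partial_{u_2}$ and the covector $\eta=a\,du_1-du_2$, with dual vector $\eta^\sharp$ with respect to $g$, satisfy $$\mathfrak{OA}(\eta^\sharp,\xi)=\frac{3a^2(-a u_1+u_2)^2}{u_2^2}.$$ 3. The orthogonal anti-bisectional curvature is non-negative: $\mathfrak{A}(\eta,\xi)\ge 0$ at every point of $T\mathbb{H}$ for all tangent vectors $\xi,\eta$ of $\mathbb{H}$ with $g(\xi,\eta)=0$. 4. $(T\mathbb{H},g^D,J^D)$ is not Hermitian symmetric: it is not true that every point $p$ has a holomorphic isometry of $T\mathbb{H}$ onto itself that fixes $p$ and has differential $-1$ there. 5. $(T\mathbb{H},J^D)$ is not biholomorphic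 to $\mathbb{C}^2$. -/

import Mathlib

open Set Filter Topology MeasureTheory ProbabilityTheory
open scoped ContDiff ENNReal

noncomputable section

namespace KaehlerSasaki

/-! ### Riemannian and complex geometry on an open subset of a finite-dimensional vector space

Tensor fields on an open set `U` of `V` are written in the global affine coordinates of `V`, so that
all tangent spaces are `V`. -/

section Geometry

variable {V : Type*} [NormedAddCommGroup V] [NormedSpace ℝ V]
variable {W : Type*} [NormedAddCommGroup W] [NormedSpace ℝ W]

/-- A smooth Riemannian metric on `U`. -/
structure IsRiemannianMetric (U : Set V) (g : V → V →L[ℝ] V →L[ℝ] ℝ) : Prop where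
  smooth : ContDiffOn ℝ ∞ g U
  symm : ∀ p ∈ U, ∀ X Y, g p X Y = g p Y X
  pos : ∀ p ∈ U, ∀ X, X ≠ 0 → 0 < g p X X

/-- The covector `Z ↦ ½ (X g(Y,Z) + Y g(X,Z) - Z g(X,Y))` for constant fields `X`, `Y`, `Z`. -/
def koszul (g : V → V →L[ℝ] V →L[ℝ] ℝ) (p X Y : V) : V →L[ℝ] ℝ :=
  (1 / 2 : ℝ) •
    (fderiv ℝ g p X Y + fderiv ℝ g p Y X - ((fderiv ℝ g p).flip X).flip Y)

/-- The vector dual to a covector with respect to the metric. -/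
def sharp (g : V → V →L[ℝ] V →L[ℝ] ℝ) (p : V) (α : V →L[ℝ] ℝ) : V :=
  (g p).inverse α

/-- The Levi-Civita derivative `∇_X Y` at `p` of the constant vector fields `X`, `Y`
(the Christoffel symbols of the metric). -/
def leviCivita (g : V → V →L[ℝ] V →L[ℝ] ℝ) (p X Y : V) : V :=
  sharp g p (koszul g p X Y)

/-- The curvature operator `R(X,Y)Z = ∇_X ∇_Y Z - ∇_Y ∇_X Z` for constant fields `X`, `Y`, `Z`. -/
def curvatureOp (g : V → V →L[ℝ] V →L[ℝ] ℝ) (p X Y Z : V) : V :=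
  fderiv ℝ (fun q => leviCivita g q Y Z) p X + leviCivita g p X (leviCivita g p Y Z)
    - (fderiv ℝ (fun q => leviCivita g q X Z) p Y + leviCivita g p Y (leviCivita g p X Z))

/-- The curvature tensor `R(X,Y,Z,W) = g(R(X,Y)W, Z)`; the sign is such that `R(X,Y,X,Y)` is the
sectional curvature of the plane spanned by orthonormal vectors `X`, `Y`. -/
def curvature (g : V → V →L[ℝ] V →L[ℝ] ℝ) (p X Y Z W : V) : ℝ :=
  g p (curvatureOp g p X Y W) Z

/-- The length of a curve `γ` defined on `[0,1]`. -/
def curveLength (g : V → V →L[ℝ] V →L[ℝ] ℝ) (γ : ℝ → V) : ℝ≥0∞ :=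
  ∫⁻ t in Icc (0 : ℝ) 1, ENNReal.ofReal
    (Real.sqrt (g (γ t) (derivWithin γ (Icc 0 1) t) (derivWithin γ (Icc 0 1) t)))

/-- The Riemannian distance of `(U, g)`: the infimum of the lengths of the `C¹` curves in `U`
from `x` to `y`. -/
def riemannianDist (U : Set V) (g : V → V →L[ℝ] V →L[ℝ] ℝ) (x y : V) : ℝ≥0∞ :=
  ⨅ (γ : ℝ → V) (_ : ContDiffOn ℝ 1 γ (Icc 0 1) ∧ MapsTo γ (Icc 0 1) U ∧ γ 0 = x ∧ γ 1 = y),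
    curveLength g γ

/-- Completeness of the metric space `(U, riemannianDist U g)`: Cauchy sequences converge. -/
def IsCompleteMetric (U : Set V) (g : V → V →L[ℝ] V →L[ℝ] ℝ) : Prop :=
  ∀ x : ℕ → V, (∀ n, x n ∈ U) →
    (∀ ε : ℝ≥0∞, 0 < ε → ∃ N, ∀ m ≥ N, ∀ n ≥ N, riemannianDist U g (x m) (x n) < ε) →
    ∃ y ∈ U, Tendsto (fun n => riemannianDist U g (x n) y) atTop (𝓝 0)

/-- The Nijenhuis tensor of `J`, evaluated on the constant vector fields `X`, `Y`. -/
def nijenhuis (J : V → V →L[ℝ] V) (p X Y : V) : V :=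
  VectorField.lieBracket ℝ (fun q => J q X) (fun q => J q Y) p
    - J p (VectorField.lieBracket ℝ (fun q => J q X) (fun _ => Y) p)
    - J p (VectorField.lieBracket ℝ (fun _ => X) (fun q => J q Y) p)
    - VectorField.lieBracket ℝ (fun _ => X) (fun _ => Y) p

/-- `(U, g, J)` is a (connected) Kähler manifold: `J` is an integrable almost complex structure,
`g` is a `J`-invariant Riemannian metric and the form `ω(X,Y) = g(JX,Y)` is closed. -/
structure IsKaehlerManifold (U : Set V) (g : V → V →L[ℝ] V →L[ℝ] ℝ) (J : V → V →L[ℝ] V) :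
    Prop where
  isOpen : IsOpen U
  isConnected : IsConnected U
  metric : IsRiemannianMetric U g
  smooth : ContDiffOn ℝ ∞ J U
  sq : ∀ p ∈ U, ∀ X, J p (J p X) = -X
  integrable : ∀ p ∈ U, ∀ X Y, nijenhuis J p X Y = 0
  hermitian : ∀ p ∈ U, ∀ X Y, g p (J p X) (J p Y) = g p X Y
  closed : ∀ p ∈ U, ∀ X Y Z,
    fderiv ℝ (fun q => g q (J q Y) Z) p X + fderiv ℝ (fun q => g q (J q Z) X) p Y
      + fderiv ℝ (fun q => g q (J q X) Y) p Z = 0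

/-- `f` is holomorphic on `U` with respect to the complex structures `J` and `J'`. -/
def IsHolomorphicOn (J : V → V →L[ℝ] V) (J' : W → W →L[ℝ] W) (f : V → W) (U : Set V) : Prop :=
  DifferentiableOn ℝ f U ∧
    ∀ p ∈ U, ∀ X, fderiv ℝ f p (J p X) = J' (f p) (fderiv ℝ f p X)

/-- `(U, J)` and `(U', J')` are biholomorphic. -/
def AreBiholomorphic (U : Set V) (J : V → V →L[ℝ] V) (U' : Set W) (J' : W → W →L[ℝ] W) : Prop :=
  ∃ (f : V → W) (f' : W → V), MapsTo f U U' ∧ MapsTo f' U' U ∧ InvOn f' f U U' ∧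
    IsHolomorphicOn J J' f U ∧ IsHolomorphicOn J' J f' U'

/-- `(U, g, J)` is Hermitian symmetric: every point `p` has a holomorphic isometry `s` of `(U, g, J)`
onto itself that fixes `p` and has differential `-1` there. -/
def IsHermitianSymmetric (U : Set V) (g : V → V →L[ℝ] V →L[ℝ] ℝ) (J : V → V →L[ℝ] V) : Prop :=
  ∀ p ∈ U, ∃ s : V → V, BijOn s U U ∧ IsHolomorphicOn J J s U ∧
    (∀ q ∈ U, ∀ X Y, g (s q) (fderiv ℝ s q X) (fderiv ℝ s q Y) = g q X Y) ∧
    s p = p ∧ ∀ X, fderiv ℝ s p X = -X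

/-- The standard complex structure of a complex vector space. -/
def standardJ (F : Type*) [NormedAddCommGroup F] [NormedSpace ℂ F] [NormedSpace ℝ F]
    [SMulCommClass ℝ ℂ F] (_ : F) : F →L[ℝ] F :=
  Complex.I • ContinuousLinearMap.id ℝ F

/-- The anti-bisectional curvature `𝔄(η,ξ) = R(ξ,Jη,ξ,Jη) - R(η,ξ,η,ξ)`. -/
def antiBisectional (g : V → V →L[ℝ] V →L[ℝ] ℝ) (J : V → V →L[ℝ] V) (p η ξ : V) : ℝ :=
  curvature g p ξ (J p η) ξ (J p η) - curvature g p η ξ η ξ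

end Geometry

/-! ### The Sasaki structure on the tangent bundle of an open set

The tangent bundle of an open set `M` of `E` is `M × E`, with points `(u, v)`. An affine connection
`D` is given by its Christoffel symbols `Γ u X Y = D_X Y` on constant fields. -/

section Sasaki

variable {E : Type*} [NormedAddCommGroup E] [NormedSpace ℝ E]

/-- The total space of the tangent bundle of `M`. -/
def tangentTotal (M : Set E) : Set (E × E) := M ×ˢ (univ : Set E)

/-- The flat connection given by differentiation in the coordinates of `E`. -/
def flatConnection : E → E →L[ℝ] E →L[ℝ] E := fun _ => 0

/-- The horizontal lift `X ↦ X^H = (X, -Γ(X, v))` at `p = (u, v)`. -/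
def horizontalLift (Γ : E → E →L[ℝ] E →L[ℝ] E) (p : E × E) : E →L[ℝ] E × E :=
  (ContinuousLinearMap.id ℝ E).prod (-(Γ p.1).flip p.2)

/-- The vertical lift `X ↦ X^V = (0, X)`. -/
def verticalLift : E →L[ℝ] E × E := ContinuousLinearMap.inr ℝ E E

/-- The horizontal component of a tangent vector of the tangent bundle: `X^H + Y^V ↦ X`. -/
def horizontalPart : E × E →L[ℝ] E := ContinuousLinearMap.fst ℝ E E

/-- The vertical component of a tangent vector of the tangent bundle at `p`: `X^H + Y^V ↦ Y`. -/
def verticalPart (Γ : E → E →L[ℝ] E →L[ℝ] E) (p : E × E) : E × E →L[ℝ] E :=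
  ContinuousLinearMap.snd ℝ E E + ((Γ p.1).flip p.2).comp (ContinuousLinearMap.fst ℝ E E)

/-- The Sasaki metric `g^D`: `g^D(X^H,Y^H) = g^D(X^V,Y^V) = g(X,Y)` and `g^D(X^H,Y^V) = 0`. -/
def sasakiMetric (g : E → E →L[ℝ] E →L[ℝ] ℝ) (Γ : E → E →L[ℝ] E →L[ℝ] E) (p : E × E) :
    E × E →L[ℝ] E × E →L[ℝ] ℝ :=
  (g p.1).bilinearComp horizontalPart horizontalPart
    + (g p.1).bilinearComp (verticalPart Γ p) (verticalPart Γ p)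

/-- The almost complex structure `J^D`: `J^D X^H = X^V` and `J^D X^V = -X^H`. -/
def sasakiJ (Γ : E → E →L[ℝ] E →L[ℝ] E) (p : E × E) : E × E →L[ℝ] E × E :=
  verticalLift.comp horizontalPart - (horizontalLift Γ p).comp (verticalPart Γ p)

/-- The Hessian metric `D²Ψ`. -/
def hessian (Ψ : E → ℝ) (u : E) : E →L[ℝ] E →L[ℝ] ℝ := fderiv ℝ (fderiv ℝ Ψ) u

/-- The Kähler Sasaki metric of a potential `Ψ`: the Sasaki metric of the Hessian metric and the
flat connection. -/
def kaehlerSasakiMetric (Ψ : E → ℝ) : E × E → E × E →L[ℝ] E × E →L[ℝ] ℝ :=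
  sasakiMetric (hessian Ψ) flatConnection

/-- The complex structure of the Kähler Sasaki metric. -/
def kaehlerSasakiJ : E × E → E × E →L[ℝ] E × E := sasakiJ flatConnection

/-- The anti-bisectional curvature `𝔄(η,ξ)` of the Kähler Sasaki metric at `(u,v)`, for real vectors:
tangent vectors `η`, `ξ` of the base at `u`, extended to the tangent bundle by horizontal lift. -/
def realAntiBisectional (Ψ : E → ℝ) (u v η ξ : E) : ℝ :=
  antiBisectional (kaehlerSasakiMetric Ψ) kaehlerSasakiJ (u, v)
    (horizontalLift flatConnection (u, v) η) (horizontalLift flatConnection (u, v) ξ)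

/-- Non-negative orthogonal anti-bisectional curvature (NOAB) of the Kähler Sasaki metric:
`𝔄(η,ξ) ≥ 0` for all orthogonal real vectors `η`, `ξ`. -/
def HasNOAB (M : Set E) (Ψ : E → ℝ) : Prop :=
  ∀ u ∈ M, ∀ v η ξ : E, hessian Ψ u η ξ = 0 → 0 ≤ realAntiBisectional Ψ u v η ξ

end Sasaki

/-! ### The half-plane and the normal distributions -/

/-- The half-plane `u₂ < 0`. -/
def halfPlane : Set (Fin 2 → ℝ) := {u | u 1 < 0}

/-- The potential `Ψ(u) = -u₁²/(4u₂) - ½ log(-2u₂)`. -/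
def normalPotential (u : Fin 2 → ℝ) : ℝ :=
  -(u 0) ^ 2 / (4 * u 1) - 1 / 2 * Real.log (-2 * u 1)

/-- The mean `μ` of the normal distribution with natural parameters `u₁ = μ/σ²`,
`u₂ = -1/(2σ²)`. -/
def normalMean (u : Fin 2 → ℝ) : ℝ := -(u 0) / (2 * u 1)

/-- The variance `σ²` of the normal distribution with natural parameters `u₁ = μ/σ²`,
`u₂ = -1/(2σ²)`. -/
def normalVar (u : Fin 2 → ℝ) : NNReal := Real.toNNReal (-1 / (2 * u 1))

/-- The score: the derivative at `u`, in the direction `X`, of the log-density at the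
observation `x` of the normal distribution with natural parameters `u`. -/
def normalScore (u X : Fin 2 → ℝ) (x : ℝ) : ℝ :=
  fderiv ℝ (fun w => Real.log (gaussianPDFReal (normalMean w) (normalVar w) x)) u X

end KaehlerSasaki

end

namespace KaehlerSasaki

/-! In the coordinates `w_k = u_k + i v_k` the tangent bundle is `ℂ × {Re w₂ < 0}`, `J` is
multiplication by `i`, and the metric has the coefficients of `D²Ψ`, which do not depend on `v`. So
`J` is integrable because it is constant, and closedness of the Kähler form is the symmetry of
`D³Ψ`. The Fisher identity is the usual one for an exponential family: up to a constant the
log-density is linear in `u` minus `Ψ(u)`.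

Curvature: let `T` be `D³Ψ` with one index raised. The Levi-Civita derivative of constant fields is
the complex bilinear extension of `T/2` (`leviCivita_normalSasaki`), so the curvature is an explicit
rational expression in `u`. The vectors orthogonal to a given `ξ ≠ 0` form a line, and on it the
anti-bisectional curvature is visibly a sum of squares with positive weight
(`realAntiBisectional_orthogonal`).

Completeness: `potentialHess_self` says that `g = dμ²/σ² + (d log σ²)²/2`. A curve of bounded length
therefore changes `log(-u₂)`, and then `u₁/u₂ = -2μ`, by a bounded amount. It stays in a slab on
which the metric dominates the norm, so Cauchy sequences for the Riemannian distance converge in the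
norm, inside a closed slab.

The two negative statements rest on Liouville's theorem: holomorphic functions from `ℂ` or `ℂ²` to a
half-plane are constant. This excludes a biholomorphism from `ℂ²`. It also forces a holomorphic
isometry to preserve the leaves `ℂ × {w₂}`, on which the metric is flat; the map is then affine on
each leaf. With a fixed point and differential `-1`, its transversal derivative along the leaf would
be both complex affine and equal to `-2 Re z`, which is impossible. -/

/-! ### Derivatives of the potential up to order three -/

lemma isOpen_halfPlane : IsOpen halfPlane :=
  isOpen_lt (continuous_apply 1) continuous_const

/-- The derivative in a direction is the derivative along the line in this direction. -/
lemma fderiv_apply_eq_of_line {V F : Type*} [NormedAddCommGroup V] [NormedSpace ℝ V]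
    [NormedAddCommGroup F] [NormedSpace ℝ F] {f : V → F} {p X : V} {d : F}
    (hf : DifferentiableAt ℝ f p) (h : HasDerivAt (fun t : ℝ => f (p + t • X)) d 0) :
    fderiv ℝ f p X = d := by
  have h1 : HasDerivAt (fun t : ℝ => p + t • X) X 0 := by
    simpa using ((hasDerivAt_id (0 : ℝ)).smul_const X).const_add p
  have h2 : HasFDerivAt f (fderiv ℝ f p) (p + (0 : ℝ) • X) := by
    simpa using hf.hasFDerivAt
  exact (h2.comp_hasDerivAt (0 : ℝ) h1).unique h

lemma hasDerivAt_line_coord (p X : Fin 2 → ℝ) (i : Fin 2) :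
    HasDerivAt (fun t : ℝ => (p + t • X) i) (X i) 0 := by
  simpa using ((hasDerivAt_id (0 : ℝ)).mul_const (X i)).const_add (p i)

lemma contDiffOn_normalPotential : ContDiffOn ℝ ∞ normalPotential halfPlane := by
  unfold normalPotential
  refine ContDiffOn.sub (ContDiffOn.div (by fun_prop) (by fun_prop) ?_)
    (contDiffOn_const.mul (ContDiffOn.log (by fun_prop) ?_)) <;>
  · intro u hu
    have : u 1 < 0 := hu
    simp [this.ne]

lemma contDiffOn_hessian : ContDiffOn ℝ ∞ (hessian normalPotential) halfPlane :=
  (contDiffOn_normalPotential.fderiv_of_isOpen isOpen_halfPlane le_rfl).fderiv_of_isOpen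
    isOpen_halfPlane le_rfl

/-- The gradient of the potential. -/
noncomputable def potentialDeriv (x y : ℝ) (X : Fin 2 → ℝ) : ℝ :=
  -x / (2 * y) * X 0 + (x ^ 2 / (4 * y ^ 2) - 1 / (2 * y)) * X 1

/-- The second derivative of the potential. -/
noncomputable def potentialHess (x y : ℝ) (X Y : Fin 2 → ℝ) : ℝ :=
  -1 / (2 * y) * (X 0 * Y 0) + x / (2 * y ^ 2) * (X 0 * Y 1 + X 1 * Y 0)
    + (1 / (2 * y ^ 2) - x ^ 2 / (2 * y ^ 3)) * (X 1 * Y 1)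

/-- The third derivative of the potential. -/
noncomputable def potentialThird (x y : ℝ) (X Y Z : Fin 2 → ℝ) : ℝ :=
  1 / (2 * y ^ 2) * (X 0 * Y 0 * Z 1 + X 0 * Y 1 * Z 0 + X 1 * Y 0 * Z 0)
    - x / y ^ 3 * (X 0 * Y 1 * Z 1 + X 1 * Y 0 * Z 1 + X 1 * Y 1 * Z 0)
    + (3 * x ^ 2 / (2 * y ^ 4) - 1 / y ^ 3) * (X 1 * Y 1 * Z 1)

lemma hasDerivAt_potentialDeriv {x y : ℝ → ℝ} {a b t : ℝ} (hx : HasDerivAt x a t)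
    (hy : HasDerivAt y b t) (h : y t ≠ 0) (X : Fin 2 → ℝ) :
    HasDerivAt (fun s => potentialDeriv (x s) (y s) X)
      (potentialHess (x t) (y t) ![a, b] X) t := by
  unfold potentialDeriv potentialHess
  have h1 := (hx.neg.div (hy.const_mul 2) (by simpa using h)).mul_const (X 0)
  have h2 := ((hx.pow 2).div ((hy.pow 2).const_mul 4) (by simpa using h)).sub
    ((hasDerivAt_const t (1 : ℝ)).div (hy.const_mul 2) (by simpa using h))
  refine (h1.add (h2.mul_const (X 1))).congr_deriv ?_
  simp
  field_simp
  ring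

lemma hasDerivAt_potentialHess {x y : ℝ → ℝ} {a b t : ℝ} (hx : HasDerivAt x a t)
    (hy : HasDerivAt y b t) (h : y t ≠ 0) (X Y : Fin 2 → ℝ) :
    HasDerivAt (fun s => potentialHess (x s) (y s) X Y)
      (potentialThird (x t) (y t) ![a, b] X Y) t := by
  unfold potentialHess potentialThird
  have h1 := ((hasDerivAt_const t (-1 : ℝ)).div (hy.const_mul 2) (by simpa using h)).mul_const
    (X 0 * Y 0)
  have h2 := (hx.div ((hy.pow 2).const_mul 2) (by simpa using h)).mul_const
    (X 0 * Y 1 + X 1 * Y 0)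
  have h3 := (((hasDerivAt_const t (1 : ℝ)).div ((hy.pow 2).const_mul 2) (by simpa using h)).sub
    ((hx.pow 2).div ((hy.pow 3).const_mul 2) (by simpa using h))).mul_const (X 1 * Y 1)
  refine ((h1.add h2).add h3).congr_deriv ?_
  simp
  field_simp
  ring

lemma fderiv_normalPotential_apply {u : Fin 2 → ℝ} (hu : u ∈ halfPlane) (X : Fin 2 → ℝ) :
    fderiv ℝ normalPotential u X = potentialDeriv (u 0) (u 1) X := by
  have h : u 1 < 0 := hu
  have h0 := hasDerivAt_line_coord u X 0
  have h1 := hasDerivAt_line_coord u X 1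
  refine fderiv_apply_eq_of_line
    ((contDiffOn_normalPotential.contDiffAt (isOpen_halfPlane.mem_nhds hu)).differentiableAt
      (by simp)) ?_
  have := ((h0.pow 2).neg.div (h1.const_mul 4) (by simp [h.ne])).sub
    (((h1.const_mul (-2)).log (by simp [h.ne])).const_mul (1 / 2))
  refine HasDerivAt.congr_deriv this ?_
  have := h.ne
  unfold potentialDeriv
  simp
  field_simp
  ring

lemma hessian_normalPotential_apply {u : Fin 2 → ℝ} (hu : u ∈ halfPlane) (X Y : Fin 2 → ℝ) :
    hessian normalPotential u X Y = potentialHess (u 0) (u 1) X Y := by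
  have h : u 1 < 0 := hu
  have hd : DifferentiableAt ℝ (fderiv ℝ normalPotential) u :=
    ((contDiffOn_normalPotential.fderiv_of_isOpen (m := ∞) isOpen_halfPlane le_rfl).contDiffAt
      (isOpen_halfPlane.mem_nhds hu)).differentiableAt (by simp)
  have h1 : hessian normalPotential u X Y = fderiv ℝ (fun w => fderiv ℝ normalPotential w Y) u X := by
    rw [fderiv_clm_apply hd (differentiableAt_const _)]
    simp [hessian]
  have h2 : (fun w => fderiv ℝ normalPotential w Y) =ᶠ[𝓝 u]
      fun w => potentialDeriv (w 0) (w 1) Y := by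
    filter_upwards [isOpen_halfPlane.mem_nhds hu] with w hw
    exact fderiv_normalPotential_apply hw Y
  rw [h1, h2.fderiv_eq]
  refine fderiv_apply_eq_of_line ((hd.clm_apply (differentiableAt_const Y)).congr_of_eventuallyEq
    h2.symm) ?_
  refine (hasDerivAt_potentialDeriv (hasDerivAt_line_coord u X 0) (hasDerivAt_line_coord u X 1)
    (by simpa using h.ne) Y).congr_deriv ?_
  simp [potentialHess]

lemma potentialHess_symm (x y : ℝ) (X Y : Fin 2 → ℝ) :
    potentialHess x y X Y = potentialHess x y Y X := by
  unfold potentialHess; ring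

/-- The metric in terms of the differentials of the mean and of the logarithm of the variance. -/
lemma potentialHess_self {x y : ℝ} (hy : y ≠ 0) (X : Fin 2 → ℝ) :
    potentialHess x y X X =
      (X 0 - x * X 1 / y) ^ 2 / (-2 * y) + (X 1 / y) ^ 2 / 2 := by
  unfold potentialHess; field_simp; ring

lemma potentialHess_pos {x y : ℝ} (hy : y < 0) {X : Fin 2 → ℝ} (hX : X ≠ 0) :
    0 < potentialHess x y X X := by
  rw [potentialHess_self hy.ne]
  by_cases h1 : X 1 = 0
  · have h0 : X 0 ≠ 0 := fun h0 => hX (by ext i; fin_cases i <;> simp [h0, h1])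
    have : 0 < X 0 ^ 2 := by positivity
    simpa [h1] using div_pos this (by linarith : 0 < -2 * y)
  · have h2 : 0 < (X 1 / y) ^ 2 / 2 := by
      have := hy.ne
      positivity
    have h3 : 0 ≤ (X 0 - x * X 1 / y) ^ 2 / (-2 * y) :=
      div_nonneg (sq_nonneg _) (by linarith)
    linarith

lemma isRiemannianMetric_hessian : IsRiemannianMetric halfPlane (hessian normalPotential) where
  smooth := contDiffOn_hessian
  symm u hu X Y := by
    rw [hessian_normalPotential_apply hu, hessian_normalPotential_apply hu, potentialHess_symm]
  pos u hu X hX := by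
    rw [hessian_normalPotential_apply hu]
    exact potentialHess_pos hu hX

/-! ### The Hessian as Fisher information -/

lemma integrable_pow_gaussianReal (m : ℝ) (v : NNReal) (n : ℕ) :
    Integrable (fun x : ℝ => x ^ n) (gaussianReal m v) := by
  have h : MemLp id n (gaussianReal m v) := memLp_id_gaussianReal' n (by simp)
  refine (h.integrable_norm_pow').mono' (by fun_prop) ?_
  filter_upwards with x
  simp

/-- The moments are the derivatives at `0` of the moment generating function `exp(v t²/2)`. Each
derivative is a polynomial times this function, and differentiating replaces the polynomial `p` by
`p' + v t p`. -/
lemma integral_pow_gaussianReal_zero (v : NNReal) :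
    ∫ x, x ^ 2 ∂(gaussianReal 0 v) = v ∧ ∫ x, x ^ 3 ∂(gaussianReal 0 v) = 0 ∧
      ∫ x, x ^ 4 ∂(gaussianReal 0 v) = 3 * (v : ℝ) ^ 2 := by
  have key (n : ℕ) : ∫ x, x ^ n ∂(gaussianReal 0 v) =
      iteratedDeriv n (fun t => Real.exp ((v : ℝ) * t ^ 2 / 2)) 0 := by
    have := iteratedDeriv_mgf_zero (X := fun x : ℝ => x) (μ := gaussianReal 0 v) (by simp) n
    rw [mgf_fun_id_gaussianReal] at this
    simpa using this.symm
  have step (p p' : ℝ → ℝ) (hp : ∀ t, HasDerivAt p (p' t) t) :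
      deriv (fun t => p t * Real.exp ((v : ℝ) * t ^ 2 / 2)) =
        fun t => (p' t + v * t * p t) * Real.exp ((v : ℝ) * t ^ 2 / 2) := by
    funext t
    have he : HasDerivAt (fun t => Real.exp ((v : ℝ) * t ^ 2 / 2)) _ t :=
      (((hasDerivAt_pow 2 t).const_mul (v : ℝ)).div_const 2).exp
    refine ((hp t).mul he).deriv.trans ?_
    simp
    ring
  have d0 : iteratedDeriv 0 (fun t => Real.exp ((v : ℝ) * t ^ 2 / 2)) =
      fun t => 1 * Real.exp ((v : ℝ) * t ^ 2 / 2) := by simp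
  have d1 : iteratedDeriv 1 (fun t => Real.exp ((v : ℝ) * t ^ 2 / 2)) =
      fun t => (v * t) * Real.exp ((v : ℝ) * t ^ 2 / 2) := by
    rw [iteratedDeriv_succ, d0, step (fun _ => 1) (fun _ => 0) fun t => hasDerivAt_const _ _]
    simp
  have d2 : iteratedDeriv 2 (fun t => Real.exp ((v : ℝ) * t ^ 2 / 2)) =
      fun t => (v + v ^ 2 * t ^ 2) * Real.exp ((v : ℝ) * t ^ 2 / 2) := by
    rw [iteratedDeriv_succ, d1, step (fun t => v * t) (fun _ => v) fun t => by
      simpa using (hasDerivAt_id t).const_mul (v : ℝ)]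
    funext t; ring
  have d3 : iteratedDeriv 3 (fun t => Real.exp ((v : ℝ) * t ^ 2 / 2)) =
      fun t => (3 * v ^ 2 * t + v ^ 3 * t ^ 3) * Real.exp ((v : ℝ) * t ^ 2 / 2) := by
    rw [iteratedDeriv_succ, d2, step (fun t => v + v ^ 2 * t ^ 2) (fun t => 2 * v ^ 2 * t) fun t =>
      (((hasDerivAt_pow 2 t).const_mul ((v : ℝ) ^ 2)).const_add (v : ℝ)).congr_deriv
        (by simp; ring)]
    funext t; ring
  have d4 : iteratedDeriv 4 (fun t => Real.exp ((v : ℝ) * t ^ 2 / 2)) =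
      fun t => (3 * v ^ 2 + 6 * v ^ 3 * t ^ 2 + v ^ 4 * t ^ 4) *
        Real.exp ((v : ℝ) * t ^ 2 / 2) := by
    rw [iteratedDeriv_succ, d3, step (fun t => 3 * v ^ 2 * t + v ^ 3 * t ^ 3)
      (fun t => 3 * v ^ 2 + 3 * v ^ 3 * t ^ 2) fun t =>
      (((hasDerivAt_id t).const_mul (3 * (v : ℝ) ^ 2)).add
        ((hasDerivAt_pow 3 t).const_mul ((v : ℝ) ^ 3))).congr_deriv (by simp; ring)]
    funext t; ring
  rw [key, key, key, d2, d3, d4]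
  simp

/-- The integral of a product of two centred quadratic polynomials against a normal distribution. -/
lemma integral_quadratic_mul_quadratic_gaussianReal (m : ℝ) (v : NNReal) (a b c d : ℝ) :
    Integrable (fun x => (a * (x - m) + b * ((x - m) ^ 2 - v)) *
      (c * (x - m) + d * ((x - m) ^ 2 - v))) (gaussianReal m v) ∧
    ∫ x, (a * (x - m) + b * ((x - m) ^ 2 - v)) * (c * (x - m) + d * ((x - m) ^ 2 - v))
      ∂(gaussianReal m v) = a * c * v + 2 * b * d * (v : ℝ) ^ 2 := by
  set F : ℝ → ℝ := fun z => (a * z + b * (z ^ 2 - v)) * (c * z + d * (z ^ 2 - v)) with hF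
  have hmap : gaussianReal 0 v = (gaussianReal m v).map (fun x => x - m) := by
    simp [gaussianReal_map_sub_const]
  -- Coefficients of `F` in ascending powers of `z`, so that only the centred moments up to order
  -- four enter.
  set q : Fin 5 → ℝ := ![b * d * (v : ℝ) ^ 2, -(v * (a * d + b * c)), a * c - 2 * b * d * v,
    a * d + b * c, b * d] with hq
  have hF' : F = fun z => ∑ i : Fin 5, q i * z ^ (i : ℕ) := by
    funext z; simp [hF, hq, Fin.sum_univ_succ]; ring
  have hi (e : ℝ) (n : ℕ) : Integrable (fun z : ℝ => e * z ^ n) (gaussianReal 0 v) :=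
    (integrable_pow_gaussianReal 0 v n).const_mul e
  have hFi : Integrable F (gaussianReal 0 v) := by
    rw [hF']
    exact integrable_finsetSum _ fun i _ => hi (q i) i
  constructor
  · rw [hmap] at hFi
    exact hFi.comp_measurable (by fun_prop)
  · have h1 : ∫ x, F (x - m) ∂(gaussianReal m v) = ∫ z, F z ∂(gaussianReal 0 v) := by
      rw [hmap, integral_map (by fun_prop) (by simp only [hF]; fun_prop)]
    refine h1.trans ?_
    rw [hF', integral_finsetSum _ fun i _ => hi (q i) i]
    simp only [integral_const_mul]
    obtain ⟨h2, h3, h4⟩ := integral_pow_gaussianReal_zero v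
    simp [hq, Fin.sum_univ_succ] at h2 h3 h4 ⊢
    simp [h2, h3, h4]
    ring

lemma coe_normalVar {u : Fin 2 → ℝ} (hu : u ∈ halfPlane) :
    (normalVar u : ℝ) = -1 / (2 * u 1) := by
  have h : u 1 < 0 := hu
  refine Real.coe_toNNReal _ (div_nonneg_of_nonpos (by norm_num) (by linarith))

/-- The normal distributions form an exponential family with cumulant function the potential. -/
lemma log_gaussianPDFReal_normal {u : Fin 2 → ℝ} (hu : u ∈ halfPlane) (x : ℝ) :
    Real.log (gaussianPDFReal (normalMean u) (normalVar u) x) =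
      x * u 0 + x ^ 2 * u 1 - normalPotential u - 1 / 2 * Real.log (2 * Real.pi) := by
  have h : u 1 < 0 := hu
  have hpi := Real.pi_pos
  have h2 : 0 < -2 * u 1 := by linarith
  have e : 2 * Real.pi * (-1 / (2 * u 1)) = 2 * Real.pi / (-2 * u 1) := by
    field_simp
  rw [gaussianPDFReal_def, coe_normalVar hu, e]
  have h3 : 0 < 2 * Real.pi / (-2 * u 1) := by positivity
  rw [Real.log_mul (by positivity) (Real.exp_ne_zero _), Real.log_exp, Real.log_inv,
    Real.log_sqrt h3.le, Real.log_div (by positivity) h2.ne']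
  unfold normalPotential normalMean
  have := h.ne
  field_simp
  ring

/-- The score is `X₁ (x - E x) + X₂ (x² - E x²)`. Writing `x² - E x²` as `2μ(x - μ) + ((x - μ)² -
σ²)` separates two uncorrelated statistics. -/
lemma normalScore_eq {u : Fin 2 → ℝ} (hu : u ∈ halfPlane) (X : Fin 2 → ℝ) (x : ℝ) :
    normalScore u X x = (X 0 + 2 * normalMean u * X 1) * (x - normalMean u)
      + X 1 * ((x - normalMean u) ^ 2 - normalVar u) := by
  have h : u 1 < 0 := hu
  have he : (fun w => Real.log (gaussianPDFReal (normalMean w) (normalVar w) x)) =ᶠ[𝓝 u]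
      fun w => x * w 0 + x ^ 2 * w 1 - normalPotential w - 1 / 2 * Real.log (2 * Real.pi) := by
    filter_upwards [isOpen_halfPlane.mem_nhds hu] with w hw
    exact log_gaussianPDFReal_normal hw x
  have hd : HasFDerivAt normalPotential (fderiv ℝ normalPotential u) u :=
    ((contDiffOn_normalPotential.contDiffAt (isOpen_halfPlane.mem_nhds hu)).differentiableAt
      (by simp)).hasFDerivAt
  have h0 : HasFDerivAt (fun w : Fin 2 → ℝ => w 0) (ContinuousLinearMap.proj (R := ℝ) (φ := fun _ : Fin 2 => ℝ) 0) u :=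
    hasFDerivAt_apply 0 u
  have h1 : HasFDerivAt (fun w : Fin 2 → ℝ => w 1) (ContinuousLinearMap.proj (R := ℝ) (φ := fun _ : Fin 2 => ℝ) 1) u :=
    hasFDerivAt_apply 1 u
  have hf := (((h0.const_mul x).add (h1.const_mul (x ^ 2))).sub hd).sub_const
    (1 / 2 * Real.log (2 * Real.pi))
  unfold normalScore
  rw [he.fderiv_eq]
  erw [hf.fderiv]
  simp only [sub_apply, add_apply,
    smul_apply, ContinuousLinearMap.proj_apply, smul_eq_mul,
    fderiv_normalPotential_apply hu, coe_normalVar hu]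
  unfold potentialDeriv normalMean
  have := h.ne
  field_simp
  ring

/-- The two statistics in the score have variances `σ²` and `2σ⁴` and no covariance, since the third
centred moment vanishes. The resulting bilinear form is compared with the explicit Hessian. -/
lemma hessian_eq_fisher {u : Fin 2 → ℝ} (hu : u ∈ halfPlane) (X Y : Fin 2 → ℝ) :
    Integrable (fun x => normalScore u X x * normalScore u Y x)
        (gaussianReal (normalMean u) (normalVar u)) ∧
      hessian normalPotential u X Y =
        ∫ x, normalScore u X x * normalScore u Y x
          ∂(gaussianReal (normalMean u) (normalVar u)) := by
  have h : u 1 < 0 := hu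
  simp only [normalScore_eq hu]
  have := integral_quadratic_mul_quadratic_gaussianReal (normalMean u) (normalVar u)
    (X 0 + 2 * normalMean u * X 1) (X 1) (Y 0 + 2 * normalMean u * Y 1) (Y 1)
  refine ⟨this.1, ?_⟩
  rw [this.2, hessian_normalPotential_apply hu, coe_normalVar hu]
  unfold potentialHess normalMean
  have := h.ne
  field_simp
  ring

/-! ### The Sasaki metric and its Kähler structure -/

lemma contDiff_flip {F G : Type*} [NormedAddCommGroup F] [NormedSpace ℝ F]
    [NormedAddCommGroup G] [NormedSpace ℝ G] :
    ContDiff ℝ ∞ (fun L : F →L[ℝ] G →L[ℝ] ℝ => L.flip) :=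
  IsBoundedLinearMap.contDiff
    ⟨⟨fun _ _ => rfl, fun _ _ => rfl⟩, 1, one_pos, fun L => by simp⟩

section General

variable {E : Type*} [NormedAddCommGroup E] [NormedSpace ℝ E]

lemma kaehlerSasakiMetric_apply (Ψ : E → ℝ) (p A B : E × E) :
    kaehlerSasakiMetric Ψ p A B = hessian Ψ p.1 A.1 B.1 + hessian Ψ p.1 A.2 B.2 := by
  simp [kaehlerSasakiMetric, sasakiMetric, horizontalPart, verticalPart, flatConnection,
    ContinuousLinearMap.bilinearComp_apply]

lemma kaehlerSasakiJ_apply (p A : E × E) : kaehlerSasakiJ p A = (-A.2, A.1) := by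
  simp [kaehlerSasakiJ, sasakiJ, verticalLift, horizontalPart, horizontalLift, verticalPart,
    flatConnection]

lemma kaehlerSasakiJ_const (p q : E × E) : kaehlerSasakiJ p = kaehlerSasakiJ q := by
  ext A <;> simp [kaehlerSasakiJ_apply]

lemma horizontalLift_flatConnection (p : E × E) (X : E) :
    horizontalLift flatConnection p X = (X, 0) := by
  simp [horizontalLift, flatConnection]

lemma contDiffOn_kaehlerSasakiMetric {M : Set E} {Ψ : E → ℝ} (h : ContDiffOn ℝ ∞ (hessian Ψ) M) :
    ContDiffOn ℝ ∞ (kaehlerSasakiMetric Ψ) (tangentTotal M) := by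
  have h1 : ContDiffOn ℝ ∞ (fun p : E × E => hessian Ψ p.1) (tangentTotal M) :=
    h.comp contDiff_fst.contDiffOn fun p hp => hp.1
  have h2 (B : E × E →L[ℝ] E) : ContDiffOn ℝ ∞
      (fun p : E × E => (hessian Ψ p.1).bilinearComp B B) (tangentTotal M) := by
    unfold ContinuousLinearMap.bilinearComp
    exact (contDiff_flip).comp_contDiffOn
      (((contDiff_flip).comp_contDiffOn (h1.clm_comp contDiffOn_const)).clm_comp contDiffOn_const)
  have h3 : kaehlerSasakiMetric Ψ = fun p => (hessian Ψ p.1).bilinearComp horizontalPart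
      horizontalPart + (hessian Ψ p.1).bilinearComp (ContinuousLinearMap.snd ℝ E E)
        (ContinuousLinearMap.snd ℝ E E) := by
    funext p
    simp [kaehlerSasakiMetric, sasakiMetric, verticalPart, flatConnection]
  rw [h3]
  exact (h2 _).add (h2 _)

/-- Positivity makes `g p` injective, and equality of dimensions makes it invertible; without this
`ContinuousLinearMap.inverse` could take its default value `0`. -/
lemma sharp_apply {V : Type*} [NormedAddCommGroup V] [NormedSpace ℝ V]
    [FiniteDimensional ℝ V] {g : V → V →L[ℝ] V →L[ℝ] ℝ} {p : V}
    (hpos : ∀ Z, Z ≠ 0 → 0 < g p Z Z) (W : V) : sharp g p (g p W) = W := by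
  have hinj : Function.Injective (g p).toLinearMap := by
    rw [← LinearMap.ker_eq_bot, LinearMap.ker_eq_bot']
    intro Z hZ
    by_contra hne
    have := hpos Z hne
    have h0 : g p Z = 0 := hZ
    simp [h0] at this
  have hdim : Module.finrank ℝ V = Module.finrank ℝ (V →L[ℝ] ℝ) := by
    rw [← (LinearMap.toContinuousLinearMap : (V →ₗ[ℝ] ℝ) ≃ₗ[ℝ] V →L[ℝ] ℝ).finrank_eq]
    exact (Subspace.dual_finrank_eq (K := ℝ) (V := V)).symm
  have hinv : (g p).IsInvertible := by
    refine ⟨(LinearEquiv.ofInjectiveOfFinrankEq (g p).toLinearMap hinj hdim).toContinuousLinearEquiv, ?_⟩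
    ext; rfl
  exact hinv.inverse_apply_eq.2 rfl

/-- An explicit Levi-Civita derivative is recognised by the Koszul formula. -/
lemma leviCivita_eq_of_koszul {V : Type*} [NormedAddCommGroup V] [NormedSpace ℝ V]
    [FiniteDimensional ℝ V] {g : V → V →L[ℝ] V →L[ℝ] ℝ} {p X Y W : V}
    (hpos : ∀ Z, Z ≠ 0 → 0 < g p Z Z) (h : ∀ Z, g p W Z = koszul g p X Y Z) :
    leviCivita g p X Y = W := by
  have hW : koszul g p X Y = g p W := by ext Z; exact (h Z).symm
  rw [leviCivita, hW]
  exact sharp_apply hpos W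

end General

lemma isOpen_tangentTotal_halfPlane : IsOpen (tangentTotal halfPlane) :=
  isOpen_halfPlane.prod isOpen_univ

lemma normalSasaki_apply {p : (Fin 2 → ℝ) × (Fin 2 → ℝ)} (hp : p ∈ tangentTotal halfPlane)
    (A B : (Fin 2 → ℝ) × (Fin 2 → ℝ)) :
    kaehlerSasakiMetric normalPotential p A B =
      potentialHess (p.1 0) (p.1 1) A.1 B.1 + potentialHess (p.1 0) (p.1 1) A.2 B.2 := by
  rw [kaehlerSasakiMetric_apply, hessian_normalPotential_apply hp.1,
    hessian_normalPotential_apply hp.1]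

lemma isRiemannianMetric_normalSasaki :
    IsRiemannianMetric (tangentTotal halfPlane) (kaehlerSasakiMetric normalPotential) where
  smooth := contDiffOn_kaehlerSasakiMetric contDiffOn_hessian
  symm p hp X Y := by
    rw [normalSasaki_apply hp, normalSasaki_apply hp, potentialHess_symm,
      potentialHess_symm _ _ X.2]
  pos p hp X hX := by
    have hnn (Z : Fin 2 → ℝ) : 0 ≤ potentialHess (p.1 0) (p.1 1) Z Z := by
      by_cases h : Z = 0
      · simp [h, potentialHess]
      · exact (potentialHess_pos hp.1 h).le
    rw [normalSasaki_apply hp]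
    by_cases h : X.1 = 0
    · have h2 : X.2 ≠ 0 := fun h2 => hX (Prod.ext h h2)
      exact add_pos_of_nonneg_of_pos (hnn _) (potentialHess_pos hp.1 h2)
    · exact add_pos_of_pos_of_nonneg (potentialHess_pos hp.1 h) (hnn _)

lemma fderiv_normalSasaki_apply {p : (Fin 2 → ℝ) × (Fin 2 → ℝ)}
    (hp : p ∈ tangentTotal halfPlane) (X A B : (Fin 2 → ℝ) × (Fin 2 → ℝ)) :
    fderiv ℝ (fun q => kaehlerSasakiMetric normalPotential q A B) p X =
      potentialThird (p.1 0) (p.1 1) X.1 A.1 B.1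
        + potentialThird (p.1 0) (p.1 1) X.1 A.2 B.2 := by
  have h : p.1 1 < 0 := hp.1
  have hd : DifferentiableAt ℝ (kaehlerSasakiMetric normalPotential) p :=
    (isRiemannianMetric_normalSasaki.smooth.contDiffAt
      (isOpen_tangentTotal_halfPlane.mem_nhds hp)).differentiableAt (by simp)
  have he : (fun q => kaehlerSasakiMetric normalPotential q A B) =ᶠ[𝓝 p]
      fun q => potentialHess (q.1 0) (q.1 1) A.1 B.1 + potentialHess (q.1 0) (q.1 1) A.2 B.2 := by
    filter_upwards [isOpen_tangentTotal_halfPlane.mem_nhds hp] with q hq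
    exact normalSasaki_apply hq A B
  have hd' : DifferentiableAt ℝ (fun q => kaehlerSasakiMetric normalPotential q A B) p :=
    (hd.clm_apply (differentiableAt_const A)).clm_apply (differentiableAt_const B)
  rw [he.fderiv_eq]
  refine fderiv_apply_eq_of_line (hd'.congr_of_eventuallyEq he.symm) ?_
  have h0 := hasDerivAt_line_coord p.1 X.1 0
  have h1 := hasDerivAt_line_coord p.1 X.1 1
  refine ((hasDerivAt_potentialHess h0 h1 (by simpa using h.ne) A.1 B.1).add
    (hasDerivAt_potentialHess h0 h1 (by simpa using h.ne) A.2 B.2)).congr_deriv ?_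
  simp [potentialThird]

lemma fderiv_normalSasaki {p : (Fin 2 → ℝ) × (Fin 2 → ℝ)}
    (hp : p ∈ tangentTotal halfPlane) (X A B : (Fin 2 → ℝ) × (Fin 2 → ℝ)) :
    fderiv ℝ (kaehlerSasakiMetric normalPotential) p X A B =
      potentialThird (p.1 0) (p.1 1) X.1 A.1 B.1
        + potentialThird (p.1 0) (p.1 1) X.1 A.2 B.2 := by
  have hd : DifferentiableAt ℝ (kaehlerSasakiMetric normalPotential) p :=
    (isRiemannianMetric_normalSasaki.smooth.contDiffAt
      (isOpen_tangentTotal_halfPlane.mem_nhds hp)).differentiableAt (by simp)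
  rw [← fderiv_normalSasaki_apply hp, fderiv_clm_apply (hd.clm_apply (differentiableAt_const A))
    (differentiableAt_const B), fderiv_clm_apply hd (differentiableAt_const A)]
  simp

/-- In the flat coordinates `J` is constant, so every bracket in the Nijenhuis tensor vanishes. In
the cyclic sum for closedness the terms cancel by the total symmetry of the third derivative. -/
lemma isKaehlerManifold_normalSasaki :
    IsKaehlerManifold (tangentTotal halfPlane) (kaehlerSasakiMetric normalPotential)
      kaehlerSasakiJ where
  isOpen := isOpen_tangentTotal_halfPlane
  isConnected := by
    have hc : Convex ℝ halfPlane := by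
      have : halfPlane = (LinearMap.proj (R := ℝ) (φ := fun _ : Fin 2 => ℝ) 1) ⁻¹' Iio 0 := rfl
      rw [this]
      exact (convex_Iio 0).linear_preimage _
    refine (hc.prod convex_univ).isConnected ⟨(fun _ => -1, 0), ?_⟩
    simp [tangentTotal, halfPlane]
  metric := isRiemannianMetric_normalSasaki
  smooth := by
    rw [show (kaehlerSasakiJ : (Fin 2 → ℝ) × (Fin 2 → ℝ) → _) = fun _ => kaehlerSasakiJ 0 from
      funext fun p => kaehlerSasakiJ_const p 0]
    exact contDiffOn_const
  sq p _ X := by simp [kaehlerSasakiJ_apply, Prod.ext_iff]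
  integrable p _ X Y := by
    simp [nijenhuis, VectorField.lieBracket, fun q => kaehlerSasakiJ_const (E := Fin 2 → ℝ) q 0]
  hermitian p hp X Y := by
    rw [normalSasaki_apply hp, normalSasaki_apply hp]
    simp [kaehlerSasakiJ_apply, potentialHess]
    ring
  closed p hp X Y Z := by
    simp only [fun (q : (Fin 2 → ℝ) × (Fin 2 → ℝ)) => kaehlerSasakiJ_const q p]
    rw [fderiv_normalSasaki_apply hp, fderiv_normalSasaki_apply hp, fderiv_normalSasaki_apply hp]
    simp [kaehlerSasakiJ_apply, potentialThird]
    ring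

/-! ### Levi-Civita connection and anti-bisectional curvature -/

/-- The vector dual to the third derivative of the potential. -/
noncomputable def potentialChristoffel (x y : ℝ) (X Y : Fin 2 → ℝ) : Fin 2 → ℝ :=
  ![x / y * (X 0 * Y 0) - (x ^ 2 / y ^ 2 + 1 / y) * (X 0 * Y 1 + X 1 * Y 0)
      + x ^ 3 / y ^ 3 * (X 1 * Y 1),
    X 0 * Y 0 - x / y * (X 0 * Y 1 + X 1 * Y 0) + (x ^ 2 / y ^ 2 - 2 / y) * (X 1 * Y 1)]

/-- The derivative of `potentialChristoffel` in the direction `Z`. -/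
noncomputable def potentialChristoffelDeriv (x y : ℝ) (Z X Y : Fin 2 → ℝ) : Fin 2 → ℝ :=
  ![(Z 0 / y - x * Z 1 / y ^ 2) * (X 0 * Y 0)
      - (2 * x * Z 0 / y ^ 2 - 2 * x ^ 2 * Z 1 / y ^ 3 - Z 1 / y ^ 2) * (X 0 * Y 1 + X 1 * Y 0)
      + (3 * x ^ 2 * Z 0 / y ^ 3 - 3 * x ^ 3 * Z 1 / y ^ 4) * (X 1 * Y 1),
    -(Z 0 / y - x * Z 1 / y ^ 2) * (X 0 * Y 1 + X 1 * Y 0)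
      + (2 * x * Z 0 / y ^ 2 - 2 * x ^ 2 * Z 1 / y ^ 3 + 2 * Z 1 / y ^ 2) * (X 1 * Y 1)]

lemma potentialHess_potentialChristoffel {x y : ℝ} (hy : y ≠ 0) (X Y Z : Fin 2 → ℝ) :
    potentialHess x y (potentialChristoffel x y X Y) Z = potentialThird x y X Y Z := by
  simp [potentialHess, potentialChristoffel, potentialThird]
  field_simp
  ring

lemma hasDerivAt_potentialChristoffel {x y : ℝ → ℝ} {a b t : ℝ} (hx : HasDerivAt x a t)
    (hy : HasDerivAt y b t) (h : y t ≠ 0) (X Y : Fin 2 → ℝ) :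
    HasDerivAt (fun s => potentialChristoffel (x s) (y s) X Y)
      (potentialChristoffelDeriv (x t) (y t) ![a, b] X Y) t := by
  have h1 := hx.div hy h
  have h2 := (hx.pow 2).div (hy.pow 2) (pow_ne_zero 2 h)
  have h3 := (hx.pow 3).div (hy.pow 3) (pow_ne_zero 3 h)
  have h4 (c : ℝ) := (hasDerivAt_const t c).div hy h
  rw [hasDerivAt_pi]
  intro i
  fin_cases i
  · refine (((h1.mul_const (X 0 * Y 0)).sub ((h2.add (h4 1)).mul_const
      (X 0 * Y 1 + X 1 * Y 0))).add (h3.mul_const (X 1 * Y 1))).congr_deriv ?_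
    simp [potentialChristoffelDeriv]
    field_simp
    ring
  · refine (((h1.mul_const (X 0 * Y 1 + X 1 * Y 0)).const_sub (X 0 * Y 0)).add
      ((h2.sub (h4 2)).mul_const (X 1 * Y 1))).congr_deriv ?_
    simp [potentialChristoffelDeriv]
    field_simp
    ring

/-- The metric varies only with `u`, and its derivative is totally symmetric, so the Koszul formula
collapses. The result is half of `potentialChristoffel`, extended complex bilinearly to `A.1 + i
A.2` and `B.1 + i B.2`. -/
lemma leviCivita_normalSasaki {p : (Fin 2 → ℝ) × (Fin 2 → ℝ)}
    (hp : p ∈ tangentTotal halfPlane) (A B : (Fin 2 → ℝ) × (Fin 2 → ℝ)) :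
    leviCivita (kaehlerSasakiMetric normalPotential) p A B =
      (1 / 2 : ℝ) • (potentialChristoffel (p.1 0) (p.1 1) A.1 B.1
          - potentialChristoffel (p.1 0) (p.1 1) A.2 B.2,
        potentialChristoffel (p.1 0) (p.1 1) A.1 B.2
          + potentialChristoffel (p.1 0) (p.1 1) A.2 B.1) := by
  have h : p.1 1 < 0 := hp.1
  refine leviCivita_eq_of_koszul (isRiemannianMetric_normalSasaki.pos p hp) fun Z => ?_
  have hk : koszul (kaehlerSasakiMetric normalPotential) p A B Z =
      1 / 2 * (fderiv ℝ (kaehlerSasakiMetric normalPotential) p A B Z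
        + fderiv ℝ (kaehlerSasakiMetric normalPotential) p B A Z
        - fderiv ℝ (kaehlerSasakiMetric normalPotential) p Z A B) := by
    simp [koszul]
  have hs (c : ℝ) (X Y : Fin 2 → ℝ) : potentialHess (p.1 0) (p.1 1) (c • X) Y =
      c * potentialHess (p.1 0) (p.1 1) X Y := by simp [potentialHess]; ring
  have ha (X X' Y : Fin 2 → ℝ) : potentialHess (p.1 0) (p.1 1) (X + X') Y =
      potentialHess (p.1 0) (p.1 1) X Y + potentialHess (p.1 0) (p.1 1) X' Y := by
    simp [potentialHess]; ring
  have hb (X X' Y : Fin 2 → ℝ) : potentialHess (p.1 0) (p.1 1) (X - X') Y =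
      potentialHess (p.1 0) (p.1 1) X Y - potentialHess (p.1 0) (p.1 1) X' Y := by
    simp [potentialHess]; ring
  rw [hk, fderiv_normalSasaki hp, fderiv_normalSasaki hp, fderiv_normalSasaki hp,
    normalSasaki_apply hp]
  simp only [Prod.smul_fst, Prod.smul_snd, hs, ha, hb, potentialHess_potentialChristoffel h.ne]
  simp only [potentialThird]
  ring

lemma fderiv_leviCivita_normalSasaki {p : (Fin 2 → ℝ) × (Fin 2 → ℝ)}
    (hp : p ∈ tangentTotal halfPlane) (X A B : (Fin 2 → ℝ) × (Fin 2 → ℝ)) :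
    fderiv ℝ (fun q => leviCivita (kaehlerSasakiMetric normalPotential) q A B) p X =
      (1 / 2 : ℝ) • (potentialChristoffelDeriv (p.1 0) (p.1 1) X.1 A.1 B.1
          - potentialChristoffelDeriv (p.1 0) (p.1 1) X.1 A.2 B.2,
        potentialChristoffelDeriv (p.1 0) (p.1 1) X.1 A.1 B.2
          + potentialChristoffelDeriv (p.1 0) (p.1 1) X.1 A.2 B.1) := by
  have h : p.1 1 < 0 := hp.1
  have he : (fun q => leviCivita (kaehlerSasakiMetric normalPotential) q A B) =ᶠ[𝓝 p]
      fun q => (1 / 2 : ℝ) • (potentialChristoffel (q.1 0) (q.1 1) A.1 B.1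
          - potentialChristoffel (q.1 0) (q.1 1) A.2 B.2,
        potentialChristoffel (q.1 0) (q.1 1) A.1 B.2
          + potentialChristoffel (q.1 0) (q.1 1) A.2 B.1) := by
    filter_upwards [isOpen_tangentTotal_halfPlane.mem_nhds hp] with q hq
    exact leviCivita_normalSasaki hq A B
  -- A derivative along a line identifies `fderiv` only once differentiability is known, so this is
  -- shown separately.
  have hdc (Y Y' : Fin 2 → ℝ) : DifferentiableAt ℝ
      (fun q : (Fin 2 → ℝ) × (Fin 2 → ℝ) => potentialChristoffel (q.1 0) (q.1 1) Y Y') p := by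
    rw [differentiableAt_pi]
    intro i
    have h2 := pow_ne_zero 2 h.ne
    have h3 := pow_ne_zero 3 h.ne
    fin_cases i
    · simp only [potentialChristoffel, Fin.zero_eta, Matrix.cons_val_zero]
      fun_prop (disch := first | exact h.ne | assumption)
    · simp only [potentialChristoffel, Fin.mk_one, Matrix.cons_val_one, Matrix.cons_val_zero]
      fun_prop (disch := first | exact h.ne | assumption)
  rw [he.fderiv_eq]
  have hc (Y Y' : Fin 2 → ℝ) := hasDerivAt_potentialChristoffel
    (hasDerivAt_line_coord p.1 X.1 0) (hasDerivAt_line_coord p.1 X.1 1) (by simpa using h.ne) Y Y'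
  refine fderiv_apply_eq_of_line (((hdc _ _).sub (hdc _ _)).prodMk
    ((hdc _ _).add (hdc _ _)) |>.const_smul (1 / 2 : ℝ)) ?_
  refine ((((hc A.1 B.1).sub (hc A.2 B.2)).prodMk
    ((hc A.1 B.2).add (hc A.2 B.1))).const_smul (1 / 2 : ℝ)).congr_deriv ?_
  simp [potentialChristoffelDeriv]

/-- The entries come from inverting the `2 × 2` Hessian matrix; applying the metric to the vector
confirms them. -/
lemma sharp_hessian {u : Fin 2 → ℝ} (hu : u ∈ halfPlane) (a b : ℝ) :
    sharp (hessian normalPotential) u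
        (a • ContinuousLinearMap.proj 0 + b • ContinuousLinearMap.proj 1) =
      ![(2 * u 0 ^ 2 - 2 * u 1) * a + 2 * u 0 * u 1 * b, 2 * u 0 * u 1 * a + 2 * u 1 ^ 2 * b] := by
  have h : u 1 ≠ 0 := ne_of_lt hu
  set W := ![(2 * u 0 ^ 2 - 2 * u 1) * a + 2 * u 0 * u 1 * b,
    2 * u 0 * u 1 * a + 2 * u 1 ^ 2 * b] with hW
  have : a • ContinuousLinearMap.proj 0 + b • ContinuousLinearMap.proj 1
      = hessian normalPotential u W := by
    refine ContinuousLinearMap.ext fun Z => ?_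
    rw [hessian_normalPotential_apply hu]
    simp [hW, potentialHess]
    field_simp
    ring
  rw [this]
  exact sharp_apply (isRiemannianMetric_hessian.pos u hu) W

/-- Here `ξ^H = (ξ, 0)` and `J η^H = (0, η)`. Derivatives in the vertical direction vanish, and the
minus sign of `i² = -1` appears whenever two vertical arguments meet. -/
lemma realAntiBisectional_eq {u : Fin 2 → ℝ} (hu : u ∈ halfPlane) (v η ξ : Fin 2 → ℝ) :
    realAntiBisectional normalPotential u v η ξ =
      potentialHess (u 0) (u 1)
        (-(1 / 2 : ℝ) • potentialChristoffelDeriv (u 0) (u 1) ξ η η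
          - (1 / 4 : ℝ) • potentialChristoffel (u 0) (u 1) ξ
              (potentialChristoffel (u 0) (u 1) η η)
          + (1 / 4 : ℝ) • potentialChristoffel (u 0) (u 1) η
              (potentialChristoffel (u 0) (u 1) ξ η)) ξ
      - potentialHess (u 0) (u 1)
        ((1 / 2 : ℝ) • (potentialChristoffelDeriv (u 0) (u 1) η ξ ξ
            - potentialChristoffelDeriv (u 0) (u 1) ξ η ξ)
          + (1 / 4 : ℝ) • (potentialChristoffel (u 0) (u 1) η
              (potentialChristoffel (u 0) (u 1) ξ ξ)
            - potentialChristoffel (u 0) (u 1) ξ (potentialChristoffel (u 0) (u 1) η ξ))) η := by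
  have hp : ((u, v) : (Fin 2 → ℝ) × (Fin 2 → ℝ)) ∈ tangentTotal halfPlane := ⟨hu, trivial⟩
  simp only [realAntiBisectional, antiBisectional, curvature, curvatureOp,
    horizontalLift_flatConnection, kaehlerSasakiJ_apply, fderiv_leviCivita_normalSasaki hp,
    leviCivita_normalSasaki hp, normalSasaki_apply hp]
  simp [potentialHess, potentialChristoffel, potentialChristoffelDeriv]
  ring

/-- The orthogonal anti-bisectional curvature; `η` is the vector dual to the covector
`c (ξ₂ du₁ - ξ₁ du₂)`. -/
lemma realAntiBisectional_orthogonal {u : Fin 2 → ℝ} (hu : u ∈ halfPlane) (v ξ : Fin 2 → ℝ)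
    (c : ℝ) :
    realAntiBisectional normalPotential u v
        (c • ![(2 * u 0 ^ 2 - 2 * u 1) * ξ 1 - 2 * u 0 * u 1 * ξ 0,
          2 * u 0 * u 1 * ξ 1 - 2 * u 1 ^ 2 * ξ 0]) ξ =
      c ^ 2 * (3 * ξ 1 ^ 2 * (ξ 0 * u 1 - ξ 1 * u 0) ^ 2 / u 1 ^ 2) := by
  have h : u 1 ≠ 0 := ne_of_lt hu
  rw [realAntiBisectional_eq hu]
  simp [potentialHess, potentialChristoffel, potentialChristoffelDeriv]
  field_simp
  ring

lemma realAntiBisectional_sharp {u : Fin 2 → ℝ} (hu : u ∈ halfPlane) (v : Fin 2 → ℝ) (a : ℝ) :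
    realAntiBisectional normalPotential u v
        (sharp (hessian normalPotential) u
          (a • ContinuousLinearMap.proj 0 - ContinuousLinearMap.proj 1)) ![1, a] =
      3 * a ^ 2 * (-(a * u 0) + u 1) ^ 2 / (u 1) ^ 2 := by
  have h1 := sharp_hessian hu a (-1)
  have h2 := realAntiBisectional_orthogonal hu v ![1, a] 1
  rw [show (-1 : ℝ) • (ContinuousLinearMap.proj 1 : (Fin 2 → ℝ) →L[ℝ] ℝ) =
      -ContinuousLinearMap.proj 1 by
        ext; simp, ← sub_eq_add_neg] at h1
  rw [h1]
  simp only [one_smul, Matrix.cons_val_zero, Matrix.cons_val_one] at h2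
  convert h2 using 2
  · congr 2 <;> ring
  · ring

/-- In dimension two the covectors annihilating `ξ ≠ 0` are the multiples of `ξ₂ du₁ - ξ₁ du₂`, so
`realAntiBisectional_orthogonal` covers every orthogonal pair with `ξ ≠ 0`. -/
lemma hasNOAB_normalPotential : HasNOAB halfPlane normalPotential := by
  intro u hu v η ξ hηξ
  have h : u 1 ≠ 0 := ne_of_lt hu
  rw [hessian_normalPotential_apply hu] at hηξ
  rcases eq_or_ne ξ 0 with rfl | hξ
  · rw [realAntiBisectional_eq hu]
    simp [potentialHess, potentialChristoffel, potentialChristoffelDeriv]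
  have hn : ξ 0 ^ 2 + ξ 1 ^ 2 ≠ 0 := by
    intro h0
    refine hξ (funext fun i => ?_)
    fin_cases i
    · simpa using (by nlinarith [sq_nonneg (ξ 0), sq_nonneg (ξ 1)] : ξ 0 ^ 2 = 0)
    · simpa using (by nlinarith [sq_nonneg (ξ 0), sq_nonneg (ξ 1)] : ξ 1 ^ 2 = 0)
  -- the components of the covector dual to `η`
  set p := -1 / (2 * u 1) * η 0 + u 0 / (2 * u 1 ^ 2) * η 1 with hp
  set q := u 0 / (2 * u 1 ^ 2) * η 0 + (1 / (2 * u 1 ^ 2) - u 0 ^ 2 / (2 * u 1 ^ 3)) * η 1 with hq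
  have hpq : p * ξ 0 + q * ξ 1 = 0 := by
    rw [← hηξ, hp, hq, potentialHess]; ring
  -- The factor `c` with `(p, q) = c (ξ₂, -ξ₁)`, obtained by projecting onto `(ξ₂, -ξ₁)`.
  set c := (p * ξ 1 - q * ξ 0) / (ξ 0 ^ 2 + ξ 1 ^ 2) with hc
  have hcp : c * ξ 1 = p := by
    rw [hc]; field_simp; linear_combination -ξ 0 * hpq
  have hcq : c * ξ 0 = -q := by
    rw [hc]; field_simp; linear_combination ξ 1 * hpq
  have hη : η = c • ![(2 * u 0 ^ 2 - 2 * u 1) * ξ 1 - 2 * u 0 * u 1 * ξ 0,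
      2 * u 0 * u 1 * ξ 1 - 2 * u 1 ^ 2 * ξ 0] := by
    funext i
    fin_cases i
    · have : η 0 = (2 * u 0 ^ 2 - 2 * u 1) * p + 2 * u 0 * u 1 * q := by
        rw [hp, hq]; field_simp; ring
      simp
      rw [this, ← hcp, ← neg_eq_iff_eq_neg.2 hcq]; ring
    · have : η 1 = 2 * u 0 * u 1 * p + 2 * u 1 ^ 2 * q := by
        rw [hp, hq]; field_simp; ring
      simp
      rw [this, ← hcp, ← neg_eq_iff_eq_neg.2 hcq]; ring
  rw [hη, realAntiBisectional_orthogonal hu]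
  positivity

/-! ### Liouville's theorem and `ℂ²` -/

/-- A real differentiable function with complex linear differential is complex differentiable. -/
lemma exists_hasFDerivAt_complex {F : Type*} [NormedAddCommGroup F] [NormedSpace ℂ F]
    [NormedSpace ℝ F] [IsScalarTower ℝ ℂ F] {f : F → ℂ} {L : F →L[ℝ] ℂ} {x : F}
    (h : HasFDerivAt f L x) (hL : ∀ X, L (Complex.I • X) = Complex.I * L X) :
    ∃ L' : F →L[ℂ] ℂ, HasFDerivAt f L' x ∧ ∀ X, L' X = L X := by
  refine ⟨{ toFun := L, map_add' := L.map_add, map_smul' := fun z X => ?_, cont := L.cont }, ?_,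
    fun X => rfl⟩
  · have h1 : z • X = z.re • X + z.im • (Complex.I • X) := by
      conv_lhs => rw [← Complex.re_add_im z]
      rw [add_smul, mul_smul, ← Complex.coe_algebraMap, algebraMap_smul, algebraMap_smul]
    rw [h1, map_add, map_smul, map_smul, hL]
    simp
    linear_combination L X * Complex.re_add_im z
  · exact hasFDerivAt_of_restrictScalars ℝ h rfl

/-- An entire function with values in the left half-plane is constant. -/
lemma apply_eq_apply_of_re_neg {F : Type*} [NormedAddCommGroup F] [NormedSpace ℂ F] {h : F → ℂ}
    (hd : Differentiable ℂ h) (hre : ∀ z, (h z).re < 0) (z w : F) : h z = h w := by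
  -- The real part of `1 - h` exceeds `1`, so `(1 - h)⁻¹` is a bounded entire function.
  have hre' (z : F) : 1 < (1 - h z).re := by
    rw [Complex.sub_re, Complex.one_re]
    linarith [hre z]
  have hne (z : F) : 1 - h z ≠ 0 := fun h0 => by
    have := hre' z
    rw [h0] at this
    norm_num at this
  have hd' : Differentiable ℂ fun z => (1 - h z)⁻¹ :=
    ((differentiable_const 1).sub hd).inv hne
  have hb : Bornology.IsBounded (range fun z => (1 - h z)⁻¹) := by
    rw [isBounded_iff_forall_norm_le]
    refine ⟨1, ?_⟩
    rintro _ ⟨z, rfl⟩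
    simp only [norm_inv]
    exact inv_le_one_of_one_le₀ ((hre' z).le.trans ((le_abs_self _).trans
      (Complex.abs_re_le_norm _)))
  have := inv_injective (hd'.apply_eq_apply_of_bounded hb z w)
  exact sub_right_injective this

/-- The holomorphic coordinate `u_k + i v_k` of the tangent bundle. -/
noncomputable def complexCoord (k : Fin 2) : (Fin 2 → ℝ) × (Fin 2 → ℝ) →L[ℝ] ℂ :=
  Complex.equivRealProdCLM.symm.toContinuousLinearMap.comp
    (((ContinuousLinearMap.proj k).comp (ContinuousLinearMap.fst ℝ _ _)).prod
      ((ContinuousLinearMap.proj k).comp (ContinuousLinearMap.snd ℝ _ _)))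

lemma complexCoord_apply (k : Fin 2) (p : (Fin 2 → ℝ) × (Fin 2 → ℝ)) :
    complexCoord k p = ⟨p.1 k, p.2 k⟩ := rfl

lemma complexCoord_kaehlerSasakiJ (k : Fin 2) (p A : (Fin 2 → ℝ) × (Fin 2 → ℝ)) :
    complexCoord k (kaehlerSasakiJ p A) = Complex.I * complexCoord k A := by
  rw [kaehlerSasakiJ_apply]
  apply Complex.ext <;> simp [complexCoord_apply]

/-- The second holomorphic coordinate of a map from `ℂ²` takes values in the left half-plane, so it
is constant, whereas the inverse of a biholomorphism would reach points with `u₂ = -1` and `u₂ =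
-2`. -/
lemma not_areBiholomorphic_normalSasaki :
    ¬ AreBiholomorphic (tangentTotal halfPlane) kaehlerSasakiJ (univ : Set (Fin 2 → ℂ))
      (standardJ (Fin 2 → ℂ)) := by
  rintro ⟨f, f', -, hf', hinv, -, hhol⟩
  have hd : Differentiable ℂ fun z => complexCoord 1 (f' z) := by
    intro z
    have h1 : HasFDerivAt f' (fderiv ℝ f' z) z :=
      ((hhol.1 z trivial).differentiableAt univ_mem).hasFDerivAt
    have h2 := (complexCoord 1).hasFDerivAt.comp z h1
    obtain ⟨L', hL', -⟩ := exists_hasFDerivAt_complex h2 fun X => by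
      have := hhol.2 z trivial X
      simp only [standardJ, smul_apply, ContinuousLinearMap.id_apply] at this
      simp only [ContinuousLinearMap.comp_apply, this, complexCoord_kaehlerSasakiJ]
    exact hL'.differentiableAt
  have hc := apply_eq_apply_of_re_neg hd fun z => (hf' (mem_univ z)).1
  have hp (y : ℝ) (hy : y < 0) : ((fun _ => y, 0) : (Fin 2 → ℝ) × (Fin 2 → ℝ)) ∈
      tangentTotal halfPlane := ⟨hy, trivial⟩
  have h3 := hc (f (fun _ => -1, 0)) (f (fun _ => -2, 0))
  rw [hinv.1 (hp _ (by norm_num)), hinv.1 (hp _ (by norm_num)), complexCoord_apply,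
    complexCoord_apply] at h3
  have := congrArg Complex.re h3
  norm_num at this

/-! ### Failure of Hermitian symmetry -/

/-- The point of the tangent bundle with given holomorphic coordinates. -/
noncomputable def ofComplexCoord : ℂ × ℂ →L[ℝ] (Fin 2 → ℝ) × (Fin 2 → ℝ) :=
  LinearMap.toContinuousLinearMap
    { toFun := fun z => (![z.1.re, z.2.re], ![z.1.im, z.2.im])
      map_add' := fun z w => by simp
      map_smul' := fun c z => by simp }

lemma ofComplexCoord_apply (z : ℂ × ℂ) :
    ofComplexCoord z = (![z.1.re, z.2.re], ![z.1.im, z.2.im]) := rfl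

lemma ofComplexCoord_I_smul (p : (Fin 2 → ℝ) × (Fin 2 → ℝ)) (z : ℂ × ℂ) :
    ofComplexCoord (Complex.I • z) = kaehlerSasakiJ p (ofComplexCoord z) := by
  simp [ofComplexCoord_apply, kaehlerSasakiJ_apply]

/-- The metric in holomorphic coordinates. -/
lemma normalSasaki_self {p : (Fin 2 → ℝ) × (Fin 2 → ℝ)} (hp : p ∈ tangentTotal halfPlane)
    (A : (Fin 2 → ℝ) × (Fin 2 → ℝ)) :
    kaehlerSasakiMetric normalPotential p A A =
      Complex.normSq (complexCoord 0 A - (p.1 0 / p.1 1 : ℝ) * complexCoord 1 A) / (-2 * p.1 1)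
        + Complex.normSq (complexCoord 1 A) / (2 * p.1 1 ^ 2) := by
  have h : p.1 1 ≠ 0 := ne_of_lt hp.1
  rw [normalSasaki_apply hp, potentialHess_self h, potentialHess_self h]
  simp only [Complex.normSq_apply, complexCoord_apply, Complex.sub_re, Complex.sub_im,
    Complex.re_ofReal_mul, Complex.im_ofReal_mul]
  field_simp
  ring

lemma complexCoord_zero_ofComplexCoord (z : ℂ × ℂ) : complexCoord 0 (ofComplexCoord z) = z.1 := by
  simp [complexCoord_apply, ofComplexCoord_apply]

lemma complexCoord_one_ofComplexCoord (z : ℂ × ℂ) : complexCoord 1 (ofComplexCoord z) = z.2 := by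
  simp [complexCoord_apply, ofComplexCoord_apply]

/-- A holomorphic self-map of the tangent bundle in holomorphic coordinates. -/
lemma exists_hasFDerivAt_complexCoord {s : (Fin 2 → ℝ) × (Fin 2 → ℝ) → (Fin 2 → ℝ) × (Fin 2 → ℝ)}
    (hs : IsHolomorphicOn kaehlerSasakiJ kaehlerSasakiJ s (tangentTotal halfPlane)) (k : Fin 2)
    {z : ℂ × ℂ} (hz : z.2.re < 0) :
    ∃ L : ℂ × ℂ →L[ℂ] ℂ, HasFDerivAt (fun w => complexCoord k (s (ofComplexCoord w))) L z ∧
      ∀ a, L a = complexCoord k (fderiv ℝ s (ofComplexCoord z) (ofComplexCoord a)) := by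
  have hU : ofComplexCoord z ∈ tangentTotal halfPlane := ⟨hz, trivial⟩
  have h1 : HasFDerivAt s (fderiv ℝ s (ofComplexCoord z)) (ofComplexCoord z) :=
    ((hs.1 _ hU).differentiableAt (isOpen_tangentTotal_halfPlane.mem_nhds hU)).hasFDerivAt
  have h2 := (complexCoord k).hasFDerivAt.comp z (h1.comp z ofComplexCoord.hasFDerivAt)
  exact exists_hasFDerivAt_complex h2 fun X => by
    simp only [ContinuousLinearMap.comp_apply, ofComplexCoord_I_smul (ofComplexCoord z),
      hs.2 _ hU, complexCoord_kaehlerSasakiJ]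

lemma not_isHermitianSymmetric_normalSasaki :
    ¬ IsHermitianSymmetric (tangentTotal halfPlane) (kaehlerSasakiMetric normalPotential)
      kaehlerSasakiJ := by
  intro H
  obtain ⟨s, hbij, hhol, hiso, hfix, hdiff⟩ := H (ofComplexCoord (0, -1))
    ⟨by simp [ofComplexCoord_apply, halfPlane], trivial⟩
  have hU {z : ℂ × ℂ} (hz : z.2.re < 0) : ofComplexCoord z ∈ tangentTotal halfPlane :=
    ⟨hz, trivial⟩
  set F : Fin 2 → ℂ × ℂ → ℂ := fun k w => complexCoord k (s (ofComplexCoord w)) with hF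
  -- The default `0` outside the domain lets one choose a single total family of complex
  -- differentials.
  have hex (k : Fin 2) (z : ℂ × ℂ) : ∃ L : ℂ × ℂ →L[ℂ] ℂ, z.2.re < 0 → HasFDerivAt (F k) L z ∧
      ∀ a, L a = complexCoord k (fderiv ℝ s (ofComplexCoord z) (ofComplexCoord a)) := by
    by_cases hz : z.2.re < 0
    · obtain ⟨L, hL⟩ := exists_hasFDerivAt_complexCoord hhol k hz
      exact ⟨L, fun _ => hL⟩
    · exact ⟨0, fun h => absurd h hz⟩
  choose L hL using hex
  have hslice (k : Fin 2) (z w : ℂ) (hw : w.re < 0) :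
      HasDerivAt (fun t => F k (t, w)) (L k (z, w) (1, 0)) z :=
    HasFDerivAt.comp_hasDerivAt z (f := fun t => (t, w)) (hL k (z, w) hw).1
      ((hasDerivAt_id z).prodMk (hasDerivAt_const z w))
  have htrans (k : Fin 2) (z w : ℂ) (hw : w.re < 0) :
      HasDerivAt (fun t => F k (z, t)) (L k (z, w) (0, 1)) w :=
    HasFDerivAt.comp_hasDerivAt w (f := fun t => (z, t)) (hL k (z, w) hw).1
      ((hasDerivAt_const w z).prodMk (hasDerivAt_id w))
  have hre {z : ℂ × ℂ} (hz : z.2.re < 0) : (F 1 z).re < 0 := (hbij.mapsTo (hU hz)).1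
  have hisom {z : ℂ × ℂ} (hz : z.2.re < 0) (a : ℂ × ℂ) :
      Complex.normSq (L 0 z a - ((F 0 z).re / (F 1 z).re : ℝ) * L 1 z a) / (-2 * (F 1 z).re)
        + Complex.normSq (L 1 z a) / (2 * (F 1 z).re ^ 2) =
      Complex.normSq (a.1 - (z.1.re / z.2.re : ℝ) * a.2) / (-2 * z.2.re)
        + Complex.normSq a.2 / (2 * z.2.re ^ 2) := by
    have h1 := hiso _ (hU hz) (ofComplexCoord a) (ofComplexCoord a)
    rw [normalSasaki_self (hbij.mapsTo (hU hz)), normalSasaki_self (hU hz),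
      complexCoord_zero_ofComplexCoord, complexCoord_one_ofComplexCoord, ← (hL 0 z hz).2,
      ← (hL 1 z hz).2] at h1
    exact h1
  -- the leaves on which the second coordinate is constant are mapped to such leaves
  have hleaf (z w : ℂ) (hw : w.re < 0) : F 1 (z, w) = F 1 (0, w) :=
    apply_eq_apply_of_re_neg (h := fun t => F 1 (t, w))
      (fun t => (hslice 1 t w hw).differentiableAt) (fun t => hre hw) z 0
  have hL10 (z w : ℂ) (hw : w.re < 0) : L 1 (z, w) (1, 0) = 0 := by
    have h1 := hslice 1 z w hw
    rw [show (fun t => F 1 (t, w)) = fun _ => F 1 (0, w) from funext fun t => hleaf t w hw] at h1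
    exact h1.unique (hasDerivAt_const _ _)
  -- the map is affine on the leaves
  have haff (w : ℂ) (hw : w.re < 0) (z : ℂ) : L 0 (z, w) (1, 0) = L 0 (0, w) (1, 0) ∧
      F 0 (z, w) = F 0 (0, w) + z * L 0 (0, w) (1, 0) := by
    have hd : Differentiable ℂ fun t => F 0 (t, w) :=
      fun t => (hslice 0 t w hw).differentiableAt
    have hder : deriv (fun t => F 0 (t, w)) = fun t => L 0 (t, w) (1, 0) :=
      funext fun t => (hslice 0 t w hw).deriv
    have hd' : Differentiable ℂ fun t => L 0 (t, w) (1, 0) := by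
      rw [← hder]
      exact (hd.contDiff (n := 2)).differentiable_deriv_two
    have hb : Bornology.IsBounded (range fun t => L 0 (t, w) (1, 0)) := by
      rw [isBounded_iff_forall_norm_le]
      -- Tangent vectors of the leaf `w` have squared length `|a|²/(-2 Re w)`, so the isometry
      -- condition fixes the modulus of the leafwise derivative to exactly this value.
      refine ⟨Real.sqrt ((F 1 (0, w)).re / w.re), ?_⟩
      rintro _ ⟨t, rfl⟩
      have h1 := hisom (z := (t, w)) hw (1, 0)
      have h2 : (F 1 (0, w)).re < 0 := hre hw
      simp only [hL10 t w hw, hleaf t w hw] at h1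
      simp only [mul_zero, sub_zero, map_zero, zero_div, add_zero, map_one] at h1
      refine Real.le_sqrt_of_sq_le (le_of_eq ?_)
      rw [← Complex.normSq_eq_norm_sq]
      have h3 := h2.ne
      have h4 := hw.ne
      field_simp at h1 ⊢
      linarith
    have hconst (t : ℂ) : L 0 (t, w) (1, 0) = L 0 (0, w) (1, 0) :=
      hd'.apply_eq_apply_of_bounded hb t 0
    refine ⟨hconst z, ?_⟩
    have h5 (t : ℂ) : HasDerivAt (fun t => F 0 (t, w) - t * L 0 (0, w) (1, 0)) 0 t := by
      refine ((hslice 0 t w hw).sub ((hasDerivAt_id t).mul_const _)).congr_deriv ?_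
      rw [hconst t]; simp
    have h6 := is_const_of_deriv_eq_zero (fun t => (h5 t).differentiableAt)
      (fun t => (h5 t).deriv) z 0
    linear_combination h6
  have hm : ((-1 : ℂ)).re < 0 := by simp
  have hF0 : F 0 (0, -1) = 0 := by
    simp only [hF, hfix, complexCoord_zero_ofComplexCoord]
  have hF1 (z : ℂ) : F 1 (z, -1) = -1 := by
    rw [hleaf z _ hm]
    simp only [hF, hfix, complexCoord_one_ofComplexCoord]
  have hL0 (a : ℂ × ℂ) : L 0 (0, -1) a = -a.1 := by
    rw [(hL 0 (0, -1) hm).2, hdiff, map_neg, complexCoord_zero_ofComplexCoord]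
  have hL1 (a : ℂ × ℂ) : L 1 (0, -1) a = -a.2 := by
    rw [(hL 1 (0, -1) hm).2, hdiff, map_neg, complexCoord_one_ofComplexCoord]
  have hnhds : ∀ᶠ t : ℂ in 𝓝 (-1), t.re < 0 :=
    (isOpen_lt Complex.continuous_re continuous_const).mem_nhds hm
  have hL1' (z : ℂ) : L 1 (z, -1) (0, 1) = -1 := by
    have h1 := htrans 1 z (-1) hm
    have h2 : (fun t => F 1 (z, t)) =ᶠ[𝓝 (-1)] fun t => F 1 (0, t) := by
      filter_upwards [hnhds] with t ht using hleaf z t ht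
    rw [h1.unique ((htrans 1 0 (-1) hm).congr_of_eventuallyEq h2), hL1]
  -- the transversal derivative of the first coordinate is affine along the leaf and real
  have hB (z : ℂ) : L 0 (z, -1) (0, 1) =
      L 0 (0, -1) (0, 1) + z * (L 0 (1, -1) (0, 1) - L 0 (0, -1) (0, 1)) := by
    have h2 : (fun t => F 0 (z, t)) =ᶠ[𝓝 (-1)]
        fun t => F 0 (0, t) + z * (F 0 (1, t) - F 0 (0, t)) := by
      filter_upwards [hnhds] with t ht
      rw [(haff t ht z).2, (haff t ht 1).2]
      ring
    have h0 := htrans 0 0 (-1) hm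
    exact (htrans 0 z (-1) hm).unique
      ((h0.add (((htrans 0 1 (-1) hm).sub h0).const_mul z)).congr_of_eventuallyEq h2)
  have hreal (z : ℂ) : L 0 (z, -1) (0, 1) = (-2 * z.re : ℝ) := by
    -- The vector `(-Re z, 1)` at `(z, -1)` is orthogonal to the leaf: the first term of its squared
    -- length is zero. The second term is preserved, so the first term is zero for the image too,
    -- and this determines the transversal derivative.
    have h1 := hisom (z := (z, -1)) hm (-z.re, 1)
    have h2 : ((-z.re, 1) : ℂ × ℂ) = (-z.re : ℂ) • (1, 0) + (0, 1) := by simp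
    have h3 : L 0 (z, -1) (-z.re, 1) = z.re + L 0 (z, -1) (0, 1) := by
      rw [h2, map_add, map_smul, (haff _ hm z).1, hL0]
      simp
    have h4 : L 1 (z, -1) (-z.re, 1) = -1 := by
      rw [h2, map_add, map_smul, hL10 _ _ hm, hL1']
      simp
    have h5 : (F 0 (z, -1)).re = -z.re := by
      rw [(haff _ hm z).2, hF0, hL0]
      simp
    rw [h3, h4, h5, hF1] at h1
    simp at h1
    rw [show -(z.re : ℂ) - z.re / -1 = 0 by ring, map_zero, Complex.normSq_eq_zero] at h1
    push_cast
    linear_combination h1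
  have h0 := hreal 0
  have h1 := hreal 1
  have hI := hreal Complex.I
  -- The affine function with values `0` at `0` and `-2` at `1` is `-2i` at `i`, whereas `hreal`
  -- gives `0`.
  rw [hB, h1, h0] at hI
  have := congrArg Complex.im hI
  norm_num at this

/-! ### Completeness -/

section Distance

variable {V : Type*} [NormedAddCommGroup V] [NormedSpace ℝ V]
variable {F : Type*} [NormedAddCommGroup F] [NormedSpace ℝ F]

/-- A function along a curve whose speed is bounded by a multiple of the speed of the curve. -/
lemma norm_sub_le_of_curveLength_le {g : V → V →L[ℝ] V →L[ℝ] ℝ} {γ : ℝ → V} {f : ℝ → F} {C ℓ : ℝ}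
    (hC : 0 ≤ C) (hℓ : 0 ≤ ℓ) (hf : ContDiffOn ℝ 1 f (Icc 0 1))
    (hbound : ∀ t ∈ Icc (0 : ℝ) 1, ‖derivWithin f (Icc 0 1) t‖ ≤ C * Real.sqrt
      (g (γ t) (derivWithin γ (Icc 0 1) t) (derivWithin γ (Icc 0 1) t)))
    (hlen : curveLength g γ ≤ ENNReal.ofReal ℓ) {t : ℝ} (ht : t ∈ Icc (0 : ℝ) 1) :
    ‖f t - f 0‖ ≤ C * ℓ := by
  have hsub : Icc (0 : ℝ) t ⊆ Icc 0 1 := Icc_subset_Icc_right ht.2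
  have h1 : ‖f t - f 0‖ₑ ≤ ENNReal.ofReal C * curveLength g γ := by
    calc ‖f t - f 0‖ₑ ≤ ∫⁻ x in Icc 0 t, ‖deriv f x‖ₑ :=
          enorm_sub_le_lintegral_deriv_of_contDiffOn_Icc (hf.mono hsub) ht.1
      -- The endpoints are discarded because `deriv` and `derivWithin` are known to agree only in
      -- the interior.
      _ = ∫⁻ x in Ioo 0 t, ‖deriv f x‖ₑ := by rw [restrict_Ioo_eq_restrict_Icc]
      _ ≤ ∫⁻ x in Ioo 0 t, ENNReal.ofReal C * ENNReal.ofReal (Real.sqrt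
            (g (γ x) (derivWithin γ (Icc 0 1) x) (derivWithin γ (Icc 0 1) x))) := by
          refine setLIntegral_mono' measurableSet_Ioo fun x hx => ?_
          have hx1 : x < 1 := hx.2.trans_le ht.2
          rw [← derivWithin_of_mem_nhds (Icc_mem_nhds hx.1 hx1), ← ENNReal.ofReal_mul hC,
            ← ofReal_norm]
          exact ENNReal.ofReal_le_ofReal (hbound x ⟨hx.1.le, hx1.le⟩)
      _ ≤ ∫⁻ x in Icc 0 1, ENNReal.ofReal C * ENNReal.ofReal (Real.sqrt
            (g (γ x) (derivWithin γ (Icc 0 1) x) (derivWithin γ (Icc 0 1) x))) :=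
          lintegral_mono_set (Ioo_subset_Icc_self.trans hsub)
      _ = ENNReal.ofReal C * curveLength g γ := by
          rw [curveLength, lintegral_const_mul' _ _ ENNReal.ofReal_ne_top]
  have h2 : ENNReal.ofReal ‖f t - f 0‖ ≤ ENNReal.ofReal (C * ℓ) := by
    rw [ofReal_norm, ENNReal.ofReal_mul hC]
    exact h1.trans (by gcongr)
  exact (ENNReal.ofReal_le_ofReal_iff (mul_nonneg hC hℓ)).1 h2

/-- The Riemannian distance is continuous for the topology of the vector space. -/
lemma tendsto_riemannianDist {U : Set V} (hU : IsOpen U) {g : V → V →L[ℝ] V →L[ℝ] ℝ} {y : V}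
    (hy : y ∈ U) (hg : ContinuousAt g y) :
    Tendsto (fun x => riemannianDist U g x y) (𝓝 y) (𝓝 0) := by
  set M := ‖g y‖ + 1 with hM
  have hM0 : 0 ≤ M := by positivity
  have hgn : Tendsto (fun q => ‖g q‖) (𝓝 y) (𝓝 ‖g y‖) :=
    ContinuousAt.norm (E := V →L[ℝ] V →L[ℝ] ℝ) hg
  have hev : ∀ᶠ q in 𝓝 y, q ∈ U ∧ ‖g q‖ < M :=
    Filter.Eventually.and (hU.mem_nhds hy) (hgn.eventually_lt_const (lt_add_one _))
  obtain ⟨r, hr, hball⟩ := Metric.eventually_nhds_iff_ball.1 hev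
  have hle : ∀ᶠ x in 𝓝 y, riemannianDist U g x y ≤ ENNReal.ofReal (Real.sqrt M * ‖y - x‖) := by
    filter_upwards [Metric.ball_mem_nhds y hr] with x hx
    have hmem (t : ℝ) (ht : t ∈ Icc (0 : ℝ) 1) : x + t • (y - x) ∈ Metric.ball y r :=
      (convex_ball y r).add_smul_sub_mem hx (Metric.mem_ball_self hr) ht
    have hder (t : ℝ) : HasDerivAt (fun t : ℝ => x + t • (y - x)) (y - x) t := by
      simpa using ((hasDerivAt_id t).smul_const (y - x)).const_add x
    refine (iInf₂_le (fun t : ℝ => x + t • (y - x)) ⟨by fun_prop,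
      fun t ht => (hball _ (hmem t ht)).1, by simp, by simp⟩).trans ?_
    unfold curveLength
    calc _ ≤ ∫⁻ _ in Icc (0 : ℝ) 1, ENNReal.ofReal (Real.sqrt M * ‖y - x‖) := by
          refine setLIntegral_mono' measurableSet_Icc fun t ht => ENNReal.ofReal_le_ofReal ?_
          rw [(hder t).hasDerivWithinAt.derivWithin (uniqueDiffOn_Icc zero_lt_one t ht)]
          refine Real.sqrt_le_iff.2 ⟨by positivity, ?_⟩
          rw [mul_pow, Real.sq_sqrt hM0, sq, ← mul_assoc]
          refine (le_abs_self _).trans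
            (((g (x + t • (y - x))).le_opNorm₂ (y - x) (y - x)).trans ?_)
          gcongr
          exact (hball _ (hmem t ht)).2.le
      _ = _ := by simp
  refine tendsto_of_tendsto_of_tendsto_of_le_of_le' tendsto_const_nhds ?_
    (Eventually.of_forall fun _ => bot_le) hle
  have h3 : Tendsto (fun x => ENNReal.ofReal (Real.sqrt M * ‖y - x‖)) (𝓝 y)
      (𝓝 (ENNReal.ofReal (Real.sqrt M * ‖y - y‖))) :=
    (ENNReal.continuous_ofReal.comp (by fun_prop)).tendsto y
  simpa using h3

end Distance

/-- The part of the tangent bundle with `a⁻¹ ≤ -u₂ ≤ a` and `|u₁| ≤ b`. -/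
def slab (a b : ℝ) : Set ((Fin 2 → ℝ) × (Fin 2 → ℝ)) :=
  {p | a⁻¹ ≤ -p.1 1 ∧ -p.1 1 ≤ a ∧ |p.1 0| ≤ b}

lemma slab_subset {a : ℝ} (ha : 0 < a) (b : ℝ) : slab a b ⊆ tangentTotal halfPlane := by
  intro p hp
  have : 0 < a⁻¹ := by positivity
  exact ⟨by have := hp.1; simp only [halfPlane, mem_ofPred_eq]; linarith, trivial⟩

lemma isClosed_slab (a b : ℝ) : IsClosed (slab a b) := by
  refine IsClosed.and ?_ (IsClosed.and ?_ ?_)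
  · exact isClosed_le (by fun_prop) (by fun_prop)
  · exact isClosed_le (by fun_prop) (by fun_prop)
  · exact isClosed_le (by fun_prop) (by fun_prop)

/-- Dropping the first square of `potentialHess_self` gives this with `√2`, rounded up to `2`. It
bounds the rate of change of `log(-u₂)` along a curve. -/
lemma abs_div_le_sqrt_potentialHess {x y : ℝ} (hy : y < 0) (X : Fin 2 → ℝ) :
    |X 1 / y| ≤ 2 * Real.sqrt (potentialHess x y X X) := by
  have h1 : 0 ≤ (X 0 - x * X 1 / y) ^ 2 / (-2 * y) := div_nonneg (sq_nonneg _) (by linarith)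
  have h2 := potentialHess_self (x := x) hy.ne X
  rw [show (2 : ℝ) = Real.sqrt 4 by rw [show (4 : ℝ) = 2 ^ 2 by norm_num]; simp,
    ← Real.sqrt_mul (by norm_num)]
  refine Real.abs_le_sqrt ?_
  nlinarith [sq_nonneg (X 1 / y)]

/-- Dropping the second square of `potentialHess_self`. The left side is `|y|` times the
differential of `x / y`, so this controls the mean once `-y` is bounded. -/
lemma abs_sub_le_sqrt_potentialHess {x y a : ℝ} (hy : y < 0) (ha : -y ≤ a) (X : Fin 2 → ℝ) :
    |X 0 - x * X 1 / y| ≤ Real.sqrt (2 * a) * Real.sqrt (potentialHess x y X X) := by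
  have h2 := potentialHess_self (x := x) hy.ne X
  have h3 : 0 ≤ potentialHess x y X X := by
    rw [h2]
    exact add_nonneg (div_nonneg (sq_nonneg _) (by linarith)) (by positivity)
  rw [← Real.sqrt_mul (by linarith)]
  refine Real.abs_le_sqrt ?_
  have h4 : (X 0 - x * X 1 / y) ^ 2 / (-2 * y) ≤ potentialHess x y X X := by
    rw [h2]; linarith [sq_nonneg (X 1 / y)]
  rw [div_le_iff₀ (by linarith)] at h4
  nlinarith

lemma norm_le_sqrt_potentialHess {x y a b : ℝ} (hy : y < 0) (ha : -y ≤ a) (hx : |x| ≤ b)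
    (X : Fin 2 → ℝ) :
    ‖X‖ ≤ (Real.sqrt (2 * a) + 2 * b + 2 * a) * Real.sqrt (potentialHess x y X X) := by
  have h1 := abs_div_le_sqrt_potentialHess (x := x) hy X
  have h2 := abs_sub_le_sqrt_potentialHess (x := x) hy ha X
  set s := Real.sqrt (potentialHess x y X X) with hs
  have hs0 : 0 ≤ s := Real.sqrt_nonneg _
  have hb : 0 ≤ b := (abs_nonneg x).trans hx
  have ha0 : 0 ≤ a := by linarith
  have hr : 0 ≤ Real.sqrt (2 * a) := Real.sqrt_nonneg _
  have h3 : |x| * |X 1 / y| ≤ b * (2 * s) := by gcongr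
  have h4 : |y| * |X 1 / y| ≤ a * (2 * s) := by
    gcongr
    rwa [abs_of_neg hy]
  rw [pi_norm_le_iff_of_nonneg (by positivity)]
  intro i
  fin_cases i
  · have e : X 0 = (X 0 - x * X 1 / y) + x * (X 1 / y) := by ring
    have h5 : |X 0| ≤ |X 0 - x * X 1 / y| + |x| * |X 1 / y| := by
      conv_lhs => rw [e]
      exact (abs_add_le _ _).trans (by rw [abs_mul])
    have : 0 ≤ a * s := by positivity
    simp only [Fin.zero_eta, Real.norm_eq_abs]
    nlinarith
  · have e : X 1 = y * (X 1 / y) := by field_simp [hy.ne]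
    have h5 : |X 1| = |y| * |X 1 / y| := by rw [← abs_mul, ← e]
    have : 0 ≤ b * s := by positivity
    have : 0 ≤ Real.sqrt (2 * a) * s := by positivity
    simp only [Fin.mk_one, Real.norm_eq_abs]
    nlinarith

/-- Short curves starting in a slab stay in a larger slab, where the metric dominates the norm. -/
lemma exists_bound_of_riemannianDist_lt {a : ℝ} (ha : 0 < a) (b : ℝ) :
    ∃ a' b' C : ℝ, 0 < a' ∧ ∀ p ∈ slab a b, ∀ q, ∀ ℓ : ℝ, 0 ≤ ℓ → ℓ ≤ 1 →
      riemannianDist (tangentTotal halfPlane) (kaehlerSasakiMetric normalPotential) p q <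
        ENNReal.ofReal ℓ → q ∈ slab a' b' ∧ ‖q - p‖ ≤ C * ℓ := by
  -- `log(-u₂)` moves by at most `2ℓ ≤ 2`, so `-u₂` changes by a factor of at most `exp 2`.
  set a' := Real.exp 2 * a with ha'
  have ha'0 : 0 < a' := by positivity
  -- From `|u₁| = |u₂| |u₁/u₂|`: the quotient starts below `a b` and moves by at most `√(2a') a'`.
  set b' := a' * (a * b + Real.sqrt (2 * a') * a') with hb'
  set C := Real.sqrt (2 * a') + 2 * b' + 2 * a' with hC
  refine ⟨a', b', C, ha'0, fun p hp q ℓ hℓ0 hℓ1 hlt => ?_⟩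
  obtain ⟨γ, hγ⟩ := iInf_lt_iff.1 hlt
  obtain ⟨⟨hγ1, hγU, hγ0, hγ1'⟩, hlen⟩ := iInf_lt_iff.1 hγ
  have hb0 : 0 ≤ b := (abs_nonneg _).trans hp.2.2
  have hb'0 : 0 ≤ b' := by positivity
  set γ' := derivWithin γ (Icc 0 1) with hγ'
  have hder {t : ℝ} (ht : t ∈ Icc (0 : ℝ) 1) : HasDerivWithinAt γ (γ' t) (Icc 0 1) t :=
    (hγ1.differentiableOn one_ne_zero t ht).hasDerivWithinAt
  have hneg {t : ℝ} (ht : t ∈ Icc (0 : ℝ) 1) : (γ t).1 1 < 0 := (hγU ht).1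
  have hcoord (i : Fin 2) {t : ℝ} (ht : t ∈ Icc (0 : ℝ) 1) :
      HasDerivWithinAt (fun t => (γ t).1 i) ((γ' t).1 i) (Icc 0 1) t :=
    hasDerivWithinAt_pi.1 (hasFDerivAt_fst.comp_hasDerivWithinAt t (hder ht)) i
  have hcd (i : Fin 2) : ContDiffOn ℝ 1 (fun t => (γ t).1 i) (Icc 0 1) :=
    contDiffOn_pi.1 (contDiff_fst.comp_contDiffOn hγ1) i
  set S : ℝ → ℝ := fun t => Real.sqrt (kaehlerSasakiMetric normalPotential (γ t) (γ' t) (γ' t))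
    with hS
  have hnn (x y : ℝ) (hy : y < 0) (X : Fin 2 → ℝ) : 0 ≤ potentialHess x y X X := by
    rw [potentialHess_self hy.ne]
    exact add_nonneg (div_nonneg (sq_nonneg _) (by linarith)) (by positivity)
  have hS1 {t : ℝ} (ht : t ∈ Icc (0 : ℝ) 1) :
      Real.sqrt (potentialHess ((γ t).1 0) ((γ t).1 1) (γ' t).1 (γ' t).1) ≤ S t := by
    refine Real.sqrt_le_sqrt ?_
    rw [normalSasaki_apply (hγU ht)]
    linarith [hnn ((γ t).1 0) _ (hneg ht) (γ' t).2]
  have hS2 {t : ℝ} (ht : t ∈ Icc (0 : ℝ) 1) :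
      Real.sqrt (potentialHess ((γ t).1 0) ((γ t).1 1) (γ' t).2 (γ' t).2) ≤ S t := by
    refine Real.sqrt_le_sqrt ?_
    rw [normalSasaki_apply (hγU ht)]
    linarith [hnn ((γ t).1 0) _ (hneg ht) (γ' t).1]
  have huniq {t : ℝ} (ht : t ∈ Icc (0 : ℝ) 1) : UniqueDiffWithinAt ℝ (Icc (0 : ℝ) 1) t :=
    uniqueDiffOn_Icc zero_lt_one t ht
  -- the logarithm of `-u₂` along the curve
  have hy {t : ℝ} (ht : t ∈ Icc (0 : ℝ) 1) : a'⁻¹ ≤ -(γ t).1 1 ∧ -(γ t).1 1 ≤ a' := by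
    have h1 := norm_sub_le_of_curveLength_le (f := fun t => Real.log (-(γ t).1 1)) (C := 2)
      (γ := γ) (by norm_num) hℓ0 ((hcd 1).neg.log fun t ht => by simpa using (hneg ht).ne)
      (fun t ht => by
        have hd : HasDerivWithinAt (fun t => Real.log (-(γ t).1 1)) ((γ' t).1 1 / (γ t).1 1)
            (Icc 0 1) t := by
          refine ((hcoord 1 ht).neg.log (by simpa using (hneg ht).ne)).congr_deriv ?_
          simp [neg_div_neg_eq]
        rw [hd.derivWithin (huniq ht), Real.norm_eq_abs]
        exact (abs_div_le_sqrt_potentialHess (hneg ht) _).trans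
          (mul_le_mul_of_nonneg_left (hS1 ht) (by norm_num))) hlen.le ht
    rw [hγ0, Real.norm_eq_abs, abs_le] at h1
    have hp0 : 0 < -p.1 1 := (by positivity : 0 < a⁻¹).trans_le hp.1
    have ht0 : 0 < -(γ t).1 1 := by linarith [hneg ht]
    constructor
    · have : -2 + Real.log (-p.1 1) ≤ Real.log (-(γ t).1 1) := by linarith [h1.1]
      rw [Real.le_log_iff_exp_le ht0, Real.exp_add, Real.exp_log hp0] at this
      refine le_trans ?_ this
      rw [ha', mul_inv, ← Real.exp_neg]
      exact mul_le_mul_of_nonneg_left hp.1 (Real.exp_pos _).le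
    · have : Real.log (-(γ t).1 1) ≤ 2 + Real.log (-p.1 1) := by linarith [h1.2]
      rw [Real.log_le_iff_le_exp ht0, Real.exp_add, Real.exp_log hp0] at this
      exact this.trans (mul_le_mul_of_nonneg_left hp.2.1 (Real.exp_pos _).le)
  have hinv {t : ℝ} (ht : t ∈ Icc (0 : ℝ) 1) : |((γ t).1 1)⁻¹| ≤ a' := by
    rw [abs_inv, abs_of_neg (hneg ht)]
    exact inv_le_of_inv_le₀ ha'0 (hy ht).1
  -- the mean, up to a factor, along the curve
  have hx {t : ℝ} (ht : t ∈ Icc (0 : ℝ) 1) : |(γ t).1 0| ≤ b' := by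
    have h1 := norm_sub_le_of_curveLength_le (f := fun t => (γ t).1 0 / (γ t).1 1)
      (C := Real.sqrt (2 * a') * a') (γ := γ) (by positivity) hℓ0
      ((hcd 0).div (hcd 1) fun t ht => (hneg ht).ne)
      (fun t ht => by
        have hd := (hcoord 0 ht).div (hcoord 1 ht) (hneg ht).ne
        have hne := (hneg ht).ne
        have e : ((γ' t).1 0 * (γ t).1 1 - (γ t).1 0 * (γ' t).1 1) / (γ t).1 1 ^ 2 =
            ((γ' t).1 0 - (γ t).1 0 * (γ' t).1 1 / (γ t).1 1) * ((γ t).1 1)⁻¹ := by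
          field_simp
        have hd' : derivWithin (fun t => (γ t).1 0 / (γ t).1 1) (Icc 0 1) t =
          ((γ' t).1 0 * (γ t).1 1 - (γ t).1 0 * (γ' t).1 1) / (γ t).1 1 ^ 2 :=
          hd.derivWithin (huniq ht)
        rw [hd', e, Real.norm_eq_abs, abs_mul]
        have h2 := (abs_sub_le_sqrt_potentialHess (x := (γ t).1 0) (hneg ht) (hy ht).2
          (γ' t).1).trans (mul_le_mul_of_nonneg_left (hS1 ht) (Real.sqrt_nonneg _))
        calc _ ≤ Real.sqrt (2 * a') * S t * a' :=
              mul_le_mul h2 (hinv ht) (abs_nonneg _) (by positivity)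
          _ = _ := by ring) hlen.le ht
    have h0 : |(γ 0).1 0 / (γ 0).1 1| ≤ a * b := by
      have : |((γ 0).1 1)⁻¹| ≤ a := by
        rw [hγ0, abs_inv, abs_of_neg (slab_subset ha b hp).1]
        exact inv_le_of_inv_le₀ ha hp.1
      rw [div_eq_mul_inv, abs_mul, mul_comm]
      refine mul_le_mul this ?_ (abs_nonneg _) ha.le
      rw [hγ0]
      exact hp.2.2
    have h2 : |(γ t).1 0 / (γ t).1 1| ≤ a * b + Real.sqrt (2 * a') * a' := by
      have h3 := abs_sub_abs_le_abs_sub ((γ t).1 0 / (γ t).1 1) ((γ 0).1 0 / (γ 0).1 1)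
      have h4 : Real.sqrt (2 * a') * a' * ℓ ≤ Real.sqrt (2 * a') * a' :=
        mul_le_of_le_one_right (by positivity) hℓ1
      rw [Real.norm_eq_abs] at h1
      linarith
    have e : (γ t).1 0 = (γ t).1 1 * ((γ t).1 0 / (γ t).1 1) := by
      have := (hneg ht).ne
      field_simp
    rw [e, abs_mul]
    refine mul_le_mul ?_ h2 (abs_nonneg _) ha'0.le
    rw [abs_of_neg (hneg ht)]
    exact (hy ht).2
  have h1 : (1 : ℝ) ∈ Icc (0 : ℝ) 1 := right_mem_Icc.2 zero_le_one
  refine ⟨?_, ?_⟩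
  · rw [← hγ1']
    exact ⟨(hy h1).1, (hy h1).2, hx h1⟩
  · have hC0 : 0 ≤ C := by positivity
    have := norm_sub_le_of_curveLength_le (f := γ) (C := C) (γ := γ) hC0 hℓ0 hγ1
      (fun t ht => by
        rw [Prod.norm_def]
        exact max_le ((norm_le_sqrt_potentialHess (hneg ht) (hy ht).2 (hx ht) _).trans
            (mul_le_mul_of_nonneg_left (hS1 ht) hC0))
          ((norm_le_sqrt_potentialHess (hneg ht) (hy ht).2 (hx ht) _).trans
            (mul_le_mul_of_nonneg_left (hS2 ht) hC0))) hlen.le h1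
    rwa [hγ0, hγ1'] at this

lemma isCompleteMetric_normalSasaki :
    IsCompleteMetric (tangentTotal halfPlane) (kaehlerSasakiMetric normalPotential) := by
  intro x hxU hx
  obtain ⟨N, hN⟩ := hx (ENNReal.ofReal 1) (by simp)
  have hneg : (x N).1 1 < 0 := (hxU N).1
  -- With `r = -u₂` at `x N`, the sum `r + r⁻¹` bounds both `r` and `r⁻¹`.
  set a := -(x N).1 1 + (-(x N).1 1)⁻¹ with ha
  have hpos : 0 < -(x N).1 1 := by linarith
  have hipos : 0 < (-(x N).1 1)⁻¹ := inv_pos.2 hpos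
  have ha0 : 0 < a := by positivity
  have hmem : x N ∈ slab a |(x N).1 0| :=
    ⟨inv_le_of_inv_le₀ hpos (by linarith), by linarith, le_rfl⟩
  obtain ⟨a', b', _, ha', h1⟩ := exists_bound_of_riemannianDist_lt ha0 |(x N).1 0|
  have hslab (n : ℕ) (hn : N ≤ n) : x n ∈ slab a' b' :=
    (h1 _ hmem _ 1 zero_le_one le_rfl (hN N le_rfl n hn)).1
  -- A second application, now started from any point of the tail, gives one constant for all pairs.
  obtain ⟨_, _, C, _, h2⟩ := exists_bound_of_riemannianDist_lt ha' b'
  have hcauchy : CauchySeq x := by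
    rw [Metric.cauchySeq_iff]
    intro ε hε
    -- The bound needs lengths at most `1`; `|C| + 1` is used since the sign of `C` is not recorded.
    set ℓ := min 1 (ε / (2 * (|C| + 1))) with hℓ
    have hℓ0 : 0 < ℓ := by positivity
    obtain ⟨N', hN'⟩ := hx (ENNReal.ofReal ℓ) (by simpa using hℓ0)
    refine ⟨max N N', fun m hm n hn => ?_⟩
    have h3 := (h2 _ (hslab m ((le_max_left _ _).trans hm)) _ ℓ hℓ0.le (min_le_left _ _)
      (hN' m ((le_max_right _ _).trans hm) n ((le_max_right _ _).trans hn))).2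
    rw [dist_comm, dist_eq_norm]
    calc ‖x n - x m‖ ≤ C * ℓ := h3
      _ ≤ (|C| + 1) * (ε / (2 * (|C| + 1))) :=
          mul_le_mul ((le_abs_self C).trans (by linarith)) (min_le_right _ _) hℓ0.le (by positivity)
      _ = ε / 2 := by field_simp
      _ < ε := by linarith
  obtain ⟨y, hy⟩ := cauchySeq_tendsto_of_complete hcauchy
  have hyU : y ∈ tangentTotal halfPlane :=
    slab_subset ha' b' ((isClosed_slab a' b').mem_of_tendsto hy (eventually_atTop.2 ⟨N, hslab⟩))
  refine ⟨y, hyU, (tendsto_riemannianDist isOpen_tangentTotal_halfPlane hyU ?_).comp hy⟩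
  exact isRiemannianMetric_normalSasaki.smooth.continuousOn.continuousAt
    (isOpen_tangentTotal_halfPlane.mem_nhds hyU)

end KaehlerSasaki

theorem mainTheorem8 :
    -- the Hessian of the potential is a Riemannian metric on the half-plane, and it is
    -- the Fisher metric of the univariate normal distributions in their natural parameters
    KaehlerSasaki.IsRiemannianMetric KaehlerSasaki.halfPlane
      (KaehlerSasaki.hessian KaehlerSasaki.normalPotential) ∧
    (∀ u ∈ KaehlerSasaki.halfPlane, ∀ X Y : Fin 2 → ℝ,
      Integrable (fun x => KaehlerSasaki.normalScore u X x * KaehlerSasaki.normalScore u Y x)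
        (gaussianReal (KaehlerSasaki.normalMean u) (KaehlerSasaki.normalVar u)) ∧
      KaehlerSasaki.hessian KaehlerSasaki.normalPotential u X Y =
        ∫ x, KaehlerSasaki.normalScore u X x * KaehlerSasaki.normalScore u Y x
          ∂(gaussianReal (KaehlerSasaki.normalMean u) (KaehlerSasaki.normalVar u))) ∧
    -- the tangent bundle is a complete Kähler surface
    KaehlerSasaki.IsKaehlerManifold (KaehlerSasaki.tangentTotal KaehlerSasaki.halfPlane)
      (KaehlerSasaki.kaehlerSasakiMetric KaehlerSasaki.normalPotential)
      KaehlerSasaki.kaehlerSasakiJ ∧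
    KaehlerSasaki.IsCompleteMetric (KaehlerSasaki.tangentTotal KaehlerSasaki.halfPlane)
      (KaehlerSasaki.kaehlerSasakiMetric KaehlerSasaki.normalPotential) ∧
    -- the orthogonal anti-bisectional curvature for `ξ = ∂₁ + a ∂₂` and `η = a du₁ - du₂`
    (∀ u ∈ KaehlerSasaki.halfPlane, ∀ (v : Fin 2 → ℝ) (a : ℝ),
      KaehlerSasaki.realAntiBisectional KaehlerSasaki.normalPotential u v
        (KaehlerSasaki.sharp (KaehlerSasaki.hessian KaehlerSasaki.normalPotential) u
          (a • ContinuousLinearMap.proj 0 - ContinuousLinearMap.proj 1))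
        ![1, a] =
      3 * a ^ 2 * (-(a * u 0) + u 1) ^ 2 / (u 1) ^ 2) ∧
    KaehlerSasaki.HasNOAB KaehlerSasaki.halfPlane KaehlerSasaki.normalPotential ∧
    -- it is neither Hermitian symmetric nor biholomorphic to `ℂ²`
    ¬ KaehlerSasaki.IsHermitianSymmetric (KaehlerSasaki.tangentTotal KaehlerSasaki.halfPlane)
      (KaehlerSasaki.kaehlerSasakiMetric KaehlerSasaki.normalPotential)
      KaehlerSasaki.kaehlerSasakiJ ∧
    ¬ KaehlerSasaki.AreBiholomorphic (KaehlerSasaki.tangentTotal KaehlerSasaki.halfPlane)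
      KaehlerSasaki.kaehlerSasakiJ (univ : Set (Fin 2 → ℂ))
      (KaehlerSasaki.standardJ (Fin 2 → ℂ)) :=
  ⟨KaehlerSasaki.isRiemannianMetric_hessian, fun _ hu X Y => KaehlerSasaki.hessian_eq_fisher hu X Y,
    KaehlerSasaki.isKaehlerManifold_normalSasaki, KaehlerSasaki.isCompleteMetric_normalSasaki,
    fun _ hu v a => KaehlerSasaki.realAntiBisectional_sharp hu v a,
    KaehlerSasaki.hasNOAB_normalPotential, KaehlerSasaki.not_isHermitianSymmetric_normalSasaki,
    KaehlerSasaki.not_areBiholomorphic_normalSasaki⟩
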